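/- Let $k$ be a field of characteristic zero and $\mathfrak g$ a Lie algebra over $k$ with basis $\hat x_1,\dots,\hat x_n$ and structure constants $[\hat x_i,\hat x_j]=\sum_l C^l_{ij}\hat x_l$. Let $\hat S(\mathfrak g^*)=k[[\partial^1,\dots,\partial^n]]$, where $\partial^1,\dots,\partial^n$ is the dual basis of $\mathfrak g^*$, with the topology of coefficientwise convergence ($k$ discrete), and write $\partial_l$ for the partial derivative of power series with respect to $\partial^l$. Let $\boldsymbol\phi:\mathfrak g\to\operatorname{Der}_k(\hat S(\mathfrak g^*))$ be a homomorphism of Lie algebras such that the matrix $\phi=(\phi^j_i)$, $\phi^j_i=\boldsymbol\phi(-\hat x_i)(\partial^j)$, is invertible over $\hat S(\mathfrak g^*)$ (for instance $\phi^j_i=\delta^j_i+O(\partial)$). Let $d\hat x_1,\dots,d\hat x_n$ be the generators of the exterior algebra $\Lambda(\mathfrak g)$ that correspond to $\hat x_1,\dots,\hat x_n$, and let $\tilde{\boldsymbol\phi}:\mathfrak g\to\operatorname{Der}_k(\Lambda(\mathfrak g)\otimes\hat S(\mathfrak g^*))$ be the unique Lie homomorphism that extends $\boldsymbol\phi$ and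 satisfies $\tilde{\boldsymbol\phi}(-\hat x_i)(d\hat x_l)=\sum_{m,r,s}d\hat x_m(\phi^{-1})^m_s(\partial_r\phi^s_l)\phi^r_i$. Let $E=U(\mathfrak g)\sharp(\Lambda(\mathfrak g)\otimes\hat S(\mathfrak g^*))$ be the extended algebra of twisted differential forms, i.e. the smash product for the right Hopf action $a\triangleleft v=\tilde{\boldsymbol\phi}(\gamma v)(a)$, where $\gamma$ is the antipode of $U(\mathfrak g)$: the space $U(\mathfrak g)\otimes(\Lambda(\mathfrak g)\otimes\hat S(\mathfrak g^*))$ with product $(u\otimes a)(v\otimes c)=\sum u v_{(1)}\otimes(a\triangleleft v_{(2)})c$. Equip $E$ with the $\partial$-adic topology, in which the left ideals $E\,\mathfrak m^N$, $\mathfrak m=(\partial^1,\dots,\partial^n)\subset\hat S(\mathfrak g^*)$, form a neighbourhood basis of $0$. Then $E$ is the algebra generated, with formal power series in the $\partial^i$ admitted, by the $3n$ symbols $d\hat x_i,\hat x_i,\partial^i$ subject to the relations $$[\hat x_i,\hat x_j]=\sum_l C^l_{ij}\hat x_l,\quad [\partial^i,\partial^j]=0,\quad [\partial^j,\hat x_i]=\phi^j_i,\quad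 [\partial^j,d\hat x_i]=0,$$ $$[d\hat x_i,\hat x_j]=\sum_{s,r,l}d\hat x_s(\phi^{-1})^s_r(\partial_l\phi^r_i)\phi^l_j,\qquad d\hat x_i\,d\hat x_j+d\hat x_j\,d\hat x_i=0 .$$ Precisely: 1. These relations hold in $E$. 2. $E$ is a Hausdorff topological ring whose topology has a neighbourhood basis of $0$ of left ideals, and the inclusion $\hat S(\mathfrak g^*)\to E$ is continuous. 3. The subalgebra generated by all $d\hat x_i,\hat x_i,\partial^i$ is dense in $E$, and the subalgebra generated by all $d\hat x_i,\hat x_i$ and $\hat S(\mathfrak g^*)$ is $E$. 4. Let $B$ be a $k$-algebra with a Hausdorff ring topology, let $Y_i,X_i,P_i\in B$ $(1\le i\le n)$, and let $e:\hat S(\mathfrak g^*)\to B$ be a continuous algebra homomorphism with $e(\partial^i)=P_i$ (evaluation of power series at the $P_i$). If the relations hold in $B$ with $d\hat x_i,\hat x_i,\partial^i$ replaced by $Y_i,X_i,P_i$ and each power series $f$ by $e(f)$, then there is a unique algebra homomorphism $F:E\to B$ with $F|_{\hat S(\mathfrak g^*)}=e$, $F(\hat x_i)=X_i$ and $F(d\hat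 x_i)=Y_i$ for all $i$. If moreover the topology of $B$ has a neighbourhood basis of $0$ of left ideals, then there is a unique continuous algebra homomorphism $F:E\to B$ with $F(\partial^i)=P_i$, $F(\hat x_i)=X_i$ and $F(d\hat x_i)=Y_i$ for all $i$. -/

import Mathlib

open scoped TensorProduct Topology

attribute [local instance 100] LieRing.ofAssociativeRing

universe u v w

noncomputable section

namespace TwistedForms

/-! ### Hopf structure of the enveloping algebra -/

section Enveloping

variable (k : Type u) [CommRing k] (𝔤 : Type v) [LieRing 𝔤] [LieAlgebra k 𝔤]

local notation "U" => UniversalEnvelopingAlgebra k 𝔤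

variable {k 𝔤} in
theorem enveloping_induction {C : UniversalEnvelopingAlgebra k 𝔤 → Prop}
    (hc : ∀ r : k, C (algebraMap k _ r))
    (hx : ∀ x : 𝔤, C (UniversalEnvelopingAlgebra.ι k x))
    (hmul : ∀ a c, C a → C c → C (a * c)) (hadd : ∀ a c, C a → C c → C (a + c))
    (u : UniversalEnvelopingAlgebra k 𝔤) : C u := by
  let s : Subalgebra k (UniversalEnvelopingAlgebra k 𝔤) :=
    { carrier := {a | C a}
      mul_mem' := fun {a c} ha hc' => hmul a c ha hc'
      add_mem' := fun {a c} ha hc' => hadd a c ha hc'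
      algebraMap_mem' := hc }
  let f : 𝔤 →ₗ⁅k⁆ s :=
    { toFun := fun x => ⟨UniversalEnvelopingAlgebra.ι k x, hx x⟩
      map_add' := fun x y => Subtype.ext (by simp)
      map_smul' := fun r x => Subtype.ext (by simp)
      map_lie' := fun {x y} => Subtype.ext (LieHom.map_lie _ x y) }
  have h : s.val.comp (UniversalEnvelopingAlgebra.lift k f) = AlgHom.id k _ := by
    apply UniversalEnvelopingAlgebra.hom_ext
    ext x
    change ((UniversalEnvelopingAlgebra.lift k f (UniversalEnvelopingAlgebra.ι k x) : s) : U) = _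
    rw [UniversalEnvelopingAlgebra.lift_ι_apply]
    rfl
  have h2 := DFunLike.congr_fun h u
  have h3 : ((UniversalEnvelopingAlgebra.lift k f u : s) : U) = u := h2
  rw [← h3]
  exact (UniversalEnvelopingAlgebra.lift k f u).2

/-- The coproduct of `U(𝔤)`: the algebra map with `Δ x = x ⊗ 1 + 1 ⊗ x` for `x ∈ 𝔤`. -/
def comul : U →ₐ[k] U ⊗[k] U :=
  UniversalEnvelopingAlgebra.lift k
    { toFun := fun x => UniversalEnvelopingAlgebra.ι k x ⊗ₜ[k] (1 : U)
        + (1 : U) ⊗ₜ[k] UniversalEnvelopingAlgebra.ι k x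
      map_add' := fun x y => by
        simp only [map_add, TensorProduct.add_tmul, TensorProduct.tmul_add]; abel
      map_smul' := fun r x => by
        simp only [map_smul, TensorProduct.smul_tmul', TensorProduct.tmul_smul, smul_add,
          RingHom.id_apply]
      map_lie' := fun {x y} => by
        simp only [LieHom.map_lie, LieRing.of_associative_ring_bracket, TensorProduct.sub_tmul,
          TensorProduct.tmul_sub, mul_add, add_mul, Algebra.TensorProduct.tmul_mul_tmul, one_mul,
          mul_one]
        abel }

/-- The antipode of `U(𝔤)`: the algebra map `U(𝔤) → U(𝔤)ᵒᵖ` with `γ x = - x` for `x ∈ 𝔤`. -/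
def antipode : U →ₐ[k] (U)ᵐᵒᵖ :=
  UniversalEnvelopingAlgebra.lift k
    { toFun := fun x => MulOpposite.op (-UniversalEnvelopingAlgebra.ι k x)
      map_add' := fun x y => by
        simp only [map_add, neg_add, MulOpposite.op_add]
      map_smul' := fun r x => by
        simp only [map_smul, ← smul_neg, MulOpposite.op_smul, RingHom.id_apply]
      map_lie' := fun {x y} => by
        simp only [LieHom.map_lie, LieRing.of_associative_ring_bracket, ← MulOpposite.op_mul,
          ← MulOpposite.op_sub, neg_mul_neg, neg_sub] }

end Enveloping

/-! ### Derivations of a possibly noncommutative algebra, and the smash product -/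

/-- The Lie algebra of `k`-linear derivations of an associative algebra `A`. -/
def Der (k : Type u) [CommRing k] (A : Type v) [Ring A] [Algebra k A] :
    LieSubalgebra k (Module.End k A) where
  carrier := {D | ∀ a c : A, D (a * c) = D a * c + a * D c}
  add_mem' := fun {D D'} h h' a c => by
    simp only [LinearMap.add_apply, h a c, h' a c]; noncomm_ring
  zero_mem' := fun a c => by simp
  smul_mem' := fun r D h a c => by
    simp only [LinearMap.smul_apply, h a c, smul_add, smul_mul_assoc, mul_smul_comm]
  lie_mem' := fun {D D'} h h' a c => by
    simp only [LieRing.of_associative_ring_bracket, LinearMap.sub_apply, Module.End.mul_apply,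
      h a c, h' a c, map_add, h _ _, h' _ _]
    noncomm_ring

section Smash

variable {k : Type u} [CommRing k] {𝔤 : Type v} [LieRing 𝔤] [LieAlgebra k 𝔤]
  {A : Type w} [Ring A] [Algebra k A] (ψ : 𝔤 →ₗ⁅k⁆ Der k A)

local notation "U" => UniversalEnvelopingAlgebra k 𝔤

/-- The left Hopf action of `U(𝔤)` on `A` that extends an action of `𝔤` by derivations. -/
def leftAction : U →ₐ[k] Module.End k A :=
  UniversalEnvelopingAlgebra.lift k ((Der k A).incl.comp ψ)

/-- The right Hopf action `a ◁ v = ψ(γ v)(a)` of `U(𝔤)` on `A`, as the linear map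
`v ↦ (a ↦ a ◁ v)`. -/
def rightAction : U →ₗ[k] Module.End k A :=
  (leftAction ψ).toLinearMap ∘ₗ (MulOpposite.opLinearEquiv k).symm.toLinearMap ∘ₗ
    (antipode k 𝔤).toLinearMap

/-- `v' ⊗ v'' ↦ (u ⊗ a ↦ u v' ⊗ (a ◁ v''))`. -/
def diagonalRight : U ⊗[k] U →ₗ[k] Module.End k (U ⊗[k] A) :=
  TensorProduct.homTensorHomMap (.id k) U A U A ∘ₗ
    TensorProduct.map (LinearMap.mul k U).flip (rightAction ψ)

/-- Right multiplication in the smash product: `v ⊗ c` is sent to the endomorphism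
`u ⊗ a ↦ ∑ u v₍₁₎ ⊗ (a ◁ v₍₂₎) c`, where `Δ v = ∑ v₍₁₎ ⊗ v₍₂₎`. -/
def smashRight : U ⊗[k] A →ₗ[k] Module.End k (U ⊗[k] A) :=
  TensorProduct.lift (LinearMap.mk₂ k
    (fun (v : U) (c : A) =>
      LinearMap.lTensor U (LinearMap.mulRight k c) ∘ₗ diagonalRight ψ (comul k 𝔤 v))
    (fun v v' c => by simp only [map_add, LinearMap.comp_add])
    (fun r v c => by simp only [map_smul, LinearMap.comp_smul])
    (fun v c c' => by
      rw [← LinearMap.add_comp, ← LinearMap.lTensor_add]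
      congr 2
      ext a; simp [mul_add])
    (fun r v c => by
      rw [← LinearMap.smul_comp, ← LinearMap.lTensor_smul]
      congr 2
      ext a; simp))

theorem rightAction_one : rightAction ψ 1 = 1 := by
  simp [rightAction]

theorem rightAction_mul (v v' : U) :
    rightAction ψ (v * v') = rightAction ψ v' * rightAction ψ v := by
  simp [rightAction]

theorem rightAction_ι (x : 𝔤) (a : A) :
    rightAction ψ (UniversalEnvelopingAlgebra.ι k x) a = -(ψ x : Module.End k A) a := by
  simp only [rightAction, antipode, leftAction, LinearMap.comp_apply, AlgHom.toLinearMap_apply,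
    UniversalEnvelopingAlgebra.lift_ι_apply]
  change (UniversalEnvelopingAlgebra.lift k ((Der k A).incl.comp ψ)
    (-UniversalEnvelopingAlgebra.ι k x)) a = _
  rw [map_neg, UniversalEnvelopingAlgebra.lift_ι_apply]
  rfl

theorem diagonalRight_tmul (p q u : U) (a : A) :
    diagonalRight ψ (p ⊗ₜ q) (u ⊗ₜ a) = (u * p) ⊗ₜ rightAction ψ q a := by
  simp [diagonalRight]

theorem diagonalRight_mul (s t : U ⊗[k] U) :
    diagonalRight ψ (s * t) = diagonalRight ψ t * diagonalRight ψ s := by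
  induction s with
  | zero => simp
  | add s s' hs hs' => rw [add_mul, map_add, hs, hs', map_add, mul_add]
  | tmul p q =>
    induction t with
    | zero => simp
    | add t t' ht ht' => rw [mul_add, map_add, ht, ht', map_add, add_mul]
    | tmul p' q' =>
      ext u a
      simp [diagonalRight_tmul, rightAction_mul, mul_assoc]

theorem smashRight_tmul (v : U) (c : A) :
    smashRight ψ (v ⊗ₜ c)
      = LinearMap.lTensor U (LinearMap.mulRight k c) ∘ₗ diagonalRight ψ (comul k 𝔤 v) := rfl

theorem diagonalRight_comul_one : diagonalRight ψ (comul k 𝔤 1) = 1 := by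
  ext u a
  simp [Algebra.TensorProduct.one_def, diagonalRight_tmul, rightAction_one]

theorem diagonalRight_comul_ι (x : 𝔤) (u : U) (a : A) :
    diagonalRight ψ (comul k 𝔤 (UniversalEnvelopingAlgebra.ι k x)) (u ⊗ₜ a)
      = (u * UniversalEnvelopingAlgebra.ι k x) ⊗ₜ a - u ⊗ₜ (ψ x : Module.End k A) a := by
  have : comul k 𝔤 (UniversalEnvelopingAlgebra.ι k x)
      = UniversalEnvelopingAlgebra.ι k x ⊗ₜ[k] (1 : U)
        + (1 : U) ⊗ₜ[k] UniversalEnvelopingAlgebra.ι k x := by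
    rw [comul, UniversalEnvelopingAlgebra.lift_ι_apply]; rfl
  rw [this, map_add, LinearMap.add_apply, diagonalRight_tmul, diagonalRight_tmul, rightAction_ι,
    rightAction_one, mul_one, TensorProduct.tmul_neg, sub_eq_add_neg]
  rfl

theorem smashRight_lTensor (c : A) (t : U ⊗[k] A) :
    smashRight ψ (LinearMap.lTensor U (LinearMap.mulRight k c) t)
      = LinearMap.lTensor U (LinearMap.mulRight k c) ∘ₗ smashRight ψ t := by
  induction t with
  | zero => simp
  | add t t' h h' => simp only [map_add, h, h', LinearMap.comp_add]
  | tmul w a =>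
    rw [LinearMap.lTensor_tmul, smashRight_tmul, smashRight_tmul, ← LinearMap.comp_assoc,
      ← LinearMap.lTensor_comp]
    congr 2
    ext e; simp [mul_assoc]

theorem smashRight_diagonal (v : U) (t : U ⊗[k] A) :
    smashRight ψ (diagonalRight ψ (comul k 𝔤 v) t)
      = diagonalRight ψ (comul k 𝔤 v) * smashRight ψ t := by
  induction v using enveloping_induction generalizing t with
  | hc r =>
    rw [Algebra.algebraMap_eq_smul_one, map_smul, map_smul, diagonalRight_comul_one]
    simp
  | hadd v v' h h' => simp only [map_add, LinearMap.add_apply, h, h', add_mul]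
  | hmul v v' h h' =>
    rw [map_mul, diagonalRight_mul, Module.End.mul_apply, h', h, mul_assoc]
  | hx x =>
    induction t with
    | zero => simp
    | add t t' h h' => simp only [map_add, h, h', mul_add]
    | tmul w a =>
      rw [diagonalRight_comul_ι, map_sub, smashRight_tmul, smashRight_tmul, smashRight_tmul,
        map_mul, diagonalRight_mul]
      refine LinearMap.ext fun s => ?_
      simp only [LinearMap.sub_apply, LinearMap.comp_apply, Module.End.mul_apply]
      generalize diagonalRight ψ (comul k 𝔤 w) s = s
      induction s with
      | zero => simp
      | add s s' h h' =>
        simp only [map_add] at h h' ⊢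
        rw [← h, ← h']; abel
      | tmul p q =>
        simp only [diagonalRight_comul_ι, map_sub, LinearMap.lTensor_tmul,
          LinearMap.mulRight_apply]
        rw [(ψ x).2 q a, TensorProduct.tmul_add]
        abel

theorem smashRight_mul (s t : U ⊗[k] A) :
    smashRight ψ (smashRight ψ t s) = smashRight ψ t * smashRight ψ s := by
  induction t with
  | zero => simp
  | add t t' h h' => simp only [map_add, LinearMap.add_apply, h, h', add_mul]
  | tmul v c =>
    rw [smashRight_tmul, LinearMap.comp_apply, smashRight_lTensor, smashRight_diagonal]
    rfl

/-- The right smash product `U(𝔤) ♯ A` for the right Hopf action `a ◁ v = ψ(γ v)(a)`: the vector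
space `U(𝔤) ⊗ A` with the product `(u ⊗ a)(v ⊗ c) = ∑ u v₍₁₎ ⊗ (a ◁ v₍₂₎) c`. -/
def SmashProduct (_ψ : 𝔤 →ₗ⁅k⁆ Der k A) : Type (max u v w) :=
  UniversalEnvelopingAlgebra k 𝔤 ⊗[k] A

namespace SmashProduct

instance : AddCommGroup (SmashProduct ψ) :=
  inferInstanceAs (AddCommGroup (U ⊗[k] A))

instance : Module k (SmashProduct ψ) :=
  inferInstanceAs (Module k (U ⊗[k] A))

/-- The pure tensor `u ⊗ a` as an element of the smash product. -/
def mk (u : U) (a : A) : SmashProduct ψ := (u ⊗ₜ[k] a : U ⊗[k] A)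

instance : Mul (SmashProduct ψ) := ⟨fun s t => (smashRight ψ t : Module.End k (U ⊗[k] A)) s⟩

instance : One (SmashProduct ψ) := ⟨mk ψ 1 1⟩

theorem mul_def (s t : SmashProduct ψ) :
    s * t = (smashRight ψ t : Module.End k (U ⊗[k] A)) s := rfl

theorem smashRight_one : smashRight ψ ((1 : U) ⊗ₜ[k] (1 : A)) = 1 := by
  rw [smashRight_tmul, diagonalRight_comul_one]
  ext u a
  simp

theorem one_smash (t : U ⊗[k] A) : smashRight ψ t ((1 : U) ⊗ₜ[k] (1 : A)) = t := by
  have key : ∀ v : U, diagonalRight ψ (comul k 𝔤 v) ((1 : U) ⊗ₜ[k] (1 : A)) = v ⊗ₜ 1 := by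
    have h1 : ∀ x : 𝔤, (ψ x : Module.End k A) 1 = 0 := fun x => by
      have := (ψ x).2 1 1
      simpa using this
    have h2 : ∀ v u : U, diagonalRight ψ (comul k 𝔤 v) (u ⊗ₜ[k] (1 : A)) = (u * v) ⊗ₜ 1 := by
      intro v
      induction v using enveloping_induction with
      | hc r =>
        intro u
        rw [Algebra.algebraMap_eq_smul_one, map_smul, map_smul, diagonalRight_comul_one]
        simp [TensorProduct.smul_tmul']
      | hx x => intro u; rw [diagonalRight_comul_ι, h1]; simp
      | hmul v v' h h' =>
        intro u
        rw [map_mul, diagonalRight_mul, Module.End.mul_apply, h, h', mul_assoc]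
      | hadd v v' h h' =>
        intro u
        simp only [map_add, LinearMap.add_apply, h, h', mul_add, TensorProduct.add_tmul]
    intro v; rw [h2, one_mul]
  induction t with
  | zero => simp
  | add t t' h h' => simp only [map_add, LinearMap.add_apply, h, h']
  | tmul v c => rw [smashRight_tmul, LinearMap.comp_apply, key]; simp

instance : Ring (SmashProduct ψ) :=
  { (inferInstance : AddCommGroup (SmashProduct ψ)),
    (inferInstance : Mul (SmashProduct ψ)), (inferInstance : One (SmashProduct ψ)) with
    left_distrib := fun s t t' =>
      DFunLike.congr_fun (map_add (smashRight ψ) (t : U ⊗[k] A) t') s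
    right_distrib := fun s s' t => map_add (smashRight ψ t) s s'
    zero_mul := fun s => map_zero (smashRight ψ s)
    mul_zero := fun s => DFunLike.congr_fun (map_zero (smashRight ψ)) s
    mul_assoc := fun s t r => (DFunLike.congr_fun (smashRight_mul ψ t r) s).symm
    one_mul := fun s => one_smash ψ s
    mul_one := fun s => DFunLike.congr_fun (smashRight_one ψ) s }

instance : Algebra k (SmashProduct ψ) :=
  Algebra.ofModule
    (fun r s t => by simp only [mul_def]; exact map_smul (smashRight ψ t) r s)
    (fun r s t => by
      simp only [mul_def]
      have : smashRight ψ (r • t) = r • smashRight ψ t := map_smul (smashRight ψ) r t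
      rw [this]; rfl)

/-- The inclusion `A → U(𝔤) ♯ A`, `a ↦ 1 ⊗ a`. -/
def inclRight : A →ₐ[k] SmashProduct ψ :=
  AlgHom.ofLinearMap (TensorProduct.mk k U A 1) rfl (fun a c => by
    change _ = smashRight ψ ((1 : U) ⊗ₜ[k] c) ((1 : U) ⊗ₜ[k] a)
    rw [smashRight_tmul, diagonalRight_comul_one]
    simp only [LinearMap.comp_apply, Module.End.one_apply, LinearMap.lTensor_tmul,
      LinearMap.mulRight_apply]
    rfl)

end SmashProduct

end Smash

/-! ### The extended action on forms with power series coefficients -/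

section Forms

variable {k : Type u} [Field k] {𝔤 : Type v} [LieRing 𝔤] [LieAlgebra k 𝔤] {n : ℕ}

/-- `Λ(𝔤) ⊗ Ŝ(𝔤*)`, where `Ŝ(𝔤*)` is the algebra of formal power series in the elements
`∂¹, …, ∂ⁿ` of the dual basis. -/
abbrev Forms (k : Type u) [Field k] (𝔤 : Type v) [LieRing 𝔤] [LieAlgebra k 𝔤] (n : ℕ) :
    Type (max u v) :=
  ExteriorAlgebra k 𝔤 ⊗[k] MvPowerSeries (Fin n) k

/-- The power series `f` as an element of `Λ(𝔤) ⊗ Ŝ(𝔤*)`. -/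
def series (k : Type u) [Field k] (𝔤 : Type v) [LieRing 𝔤] [LieAlgebra k 𝔤] (n : ℕ) :
    MvPowerSeries (Fin n) k →ₐ[k] Forms k 𝔤 n :=
  Algebra.TensorProduct.includeRight

/-- The generator `dx̂ᵢ` of `Λ(𝔤)` as an element of `Λ(𝔤) ⊗ Ŝ(𝔤*)`. -/
def dx (b : Module.Basis (Fin n) k 𝔤) (i : Fin n) : Forms k 𝔤 n :=
  ExteriorAlgebra.ι k (b i) ⊗ₜ[k] 1

/-- The matrix with entry `φʲᵢ = φ(-x̂ᵢ)(∂ʲ)` in row `j` and column `i`. -/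
def phiMatrix (b : Module.Basis (Fin n) k 𝔤)
    (φ : 𝔤 →ₗ⁅k⁆ Derivation k (MvPowerSeries (Fin n) k) (MvPowerSeries (Fin n) k)) :
    Matrix (Fin n) (Fin n) (MvPowerSeries (Fin n) k) :=
  Matrix.of fun j i => φ (-(b i)) (MvPowerSeries.X j)

/-- A matrix close to the identity, `φʲᵢ = δʲᵢ + O(∂)`, is invertible. -/
theorem isUnit_phiMatrix_of_close (b : Module.Basis (Fin n) k 𝔤)
    (φ : 𝔤 →ₗ⁅k⁆ Derivation k (MvPowerSeries (Fin n) k) (MvPowerSeries (Fin n) k))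
    (h : (phiMatrix b φ).map MvPowerSeries.constantCoeff = 1) : IsUnit (phiMatrix b φ) := by
  rw [Matrix.isUnit_iff_isUnit_det, MvPowerSeries.isUnit_iff_constantCoeff,
    RingHom.map_det, RingHom.mapMatrix_apply, h, Matrix.det_one]
  exact isUnit_one

/-- `ψ` extends `φ` to an action of `𝔤` on `Λ(𝔤) ⊗ Ŝ(𝔤*)` by derivations with
`ψ(-x̂ᵢ)(dx̂ₗ) = ∑ dx̂ₘ (φ⁻¹)ᵐₛ (∂ᵣ φˢₗ) φʳᵢ`. -/
structure IsFormExtension (b : Module.Basis (Fin n) k 𝔤)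
    (φ : 𝔤 →ₗ⁅k⁆ Derivation k (MvPowerSeries (Fin n) k) (MvPowerSeries (Fin n) k))
    (ψ : 𝔤 →ₗ⁅k⁆ Der k (Forms k 𝔤 n)) : Prop where
  apply_series : ∀ (x : 𝔤) (f : MvPowerSeries (Fin n) k),
    (ψ x : Module.End k (Forms k 𝔤 n)) (series k 𝔤 n f) = series k 𝔤 n (φ x f)
  apply_dx : ∀ i l : Fin n,
    (ψ (-(b i)) : Module.End k (Forms k 𝔤 n)) (dx b l) =
      ∑ m, ∑ r, ∑ s, dx b m * series k 𝔤 n ((phiMatrix b φ)⁻¹ m s *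
        MvPowerSeries.pderiv k r (phiMatrix b φ s l) * phiMatrix b φ r i)

theorem exists_eq_C_add_sum_X_mul (f : MvPowerSeries (Fin n) k) :
    ∃ g : Fin n → MvPowerSeries (Fin n) k,
      f = MvPowerSeries.C (MvPowerSeries.constantCoeff f) + ∑ i, g i * MvPowerSeries.X i := by
  classical
  have hex : ∀ d : Fin n →₀ ℕ, d ≠ 0 → ∃ i, d i ≠ 0 := fun d hd => by
    by_contra! h
    exact hd (Finsupp.ext h)
  choose p hp using fun d : {d : Fin n →₀ ℕ // d ≠ 0} => hex d.1 d.2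
  let c : (Fin n →₀ ℕ) → Fin n → Prop := fun d i => ∃ h : d ≠ 0, p ⟨d, h⟩ = i
  let g : Fin n → MvPowerSeries (Fin n) k := fun i e =>
    if c (e + Finsupp.single i 1) i then MvPowerSeries.coeff (e + Finsupp.single i 1) f else 0
  refine ⟨g, ?_⟩
  ext d
  rw [map_add, map_sum, MvPowerSeries.coeff_C]
  have hterm : ∀ i, MvPowerSeries.coeff d (g i * MvPowerSeries.X i)
      = if c d i then MvPowerSeries.coeff d f else 0 := by
    intro i
    rw [MvPowerSeries.X_def, MvPowerSeries.coeff_mul_monomial]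
    by_cases h : Finsupp.single i 1 ≤ d
    · rw [if_pos h, mul_one]
      change (if c (d - Finsupp.single i 1 + Finsupp.single i 1) i then
        MvPowerSeries.coeff (d - Finsupp.single i 1 + Finsupp.single i 1) f else 0) = _
      rw [tsub_add_cancel_of_le h]
    · rw [if_neg h, if_neg]
      rintro ⟨h0, rfl⟩
      apply h
      rw [Finsupp.single_le_iff]
      exact Nat.one_le_iff_ne_zero.mpr (hp ⟨d, h0⟩)
  rw [Finset.sum_congr rfl fun i _ => hterm i]
  by_cases hd : d = 0
  · subst hd
    rw [if_pos rfl, Finset.sum_eq_zero, add_zero, MvPowerSeries.coeff_zero_eq_constantCoeff_apply]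
    intro i _
    rw [if_neg]
    rintro ⟨h, -⟩
    exact h rfl
  · rw [if_neg hd, zero_add, Finset.sum_eq_single (p ⟨d, hd⟩)]
    · rw [if_pos ⟨hd, rfl⟩]
    · intro i _ hi
      rw [if_neg]
      rintro ⟨_, h⟩
      exact hi h.symm
    · simp

/-- Derivations of a power series ring satisfy the chain rule. -/
theorem derivation_apply (D : Derivation k (MvPowerSeries (Fin n) k) (MvPowerSeries (Fin n) k))
    (f : MvPowerSeries (Fin n) k) :
    D f = ∑ r, MvPowerSeries.pderiv k r f * D (MvPowerSeries.X r) := by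
  let δ : Derivation k (MvPowerSeries (Fin n) k) (MvPowerSeries (Fin n) k) :=
    D - ∑ r, D (MvPowerSeries.X r) • MvPowerSeries.pderiv k r
  have hδ : ∀ f, δ f = D f - ∑ r, MvPowerSeries.pderiv k r f * D (MvPowerSeries.X r) := by
    intro f
    have : ∀ s : Finset (Fin n), (∑ r ∈ s, D (MvPowerSeries.X r) • MvPowerSeries.pderiv k r) f
        = ∑ r ∈ s, MvPowerSeries.pderiv k r f * D (MvPowerSeries.X r) := by
      intro s
      induction s using Finset.induction_on with
      | empty => simp
      | insert a s ha ih =>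
        rw [Finset.sum_insert ha, Finset.sum_insert ha, Derivation.add_apply, ih,
          Derivation.smul_apply, smul_eq_mul, mul_comm]
    rw [← this]
    rfl
  have hX : ∀ i, δ (MvPowerSeries.X i) = 0 := by
    intro i
    rw [hδ, Finset.sum_eq_single i]
    · simp
    · intro j _ hj
      rw [MvPowerSeries.pderiv_X_of_ne (by tauto)]; simp
    · simp
  have key : ∀ N : ℕ, ∀ f, ∀ d : Fin n →₀ ℕ, d.degree < N → MvPowerSeries.coeff d (δ f) = 0 := by
    intro N
    induction N with
    | zero => intro f d hd; omega
    | succ N ih =>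
      intro f d hd
      obtain ⟨g, hg⟩ := exists_eq_C_add_sum_X_mul f
      have hC : δ (MvPowerSeries.C (MvPowerSeries.constantCoeff f)) = 0 :=
        δ.map_algebraMap _
      rw [hg, map_add, hC, zero_add, map_sum, map_sum]
      refine Finset.sum_eq_zero fun i _ => ?_
      rw [Derivation.leibniz, hX, smul_zero, zero_add, smul_eq_mul, mul_comm, MvPowerSeries.X,
        MvPowerSeries.coeff_mul_monomial]
      split_ifs with h
      · rw [ih (g i), zero_mul]
        have h2 : (d - Finsupp.single i 1 + Finsupp.single i 1).degree = d.degree := by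
          rw [tsub_add_cancel_of_le h]
        rw [map_add, Finsupp.degree_single] at h2
        omega
      · rfl
  have : δ f = 0 := by
    ext d
    rw [key (d.degree + 1) f d (by omega), map_zero]
  rw [hδ, sub_eq_zero] at this
  exact this

theorem dx_mul_dx (b : Module.Basis (Fin n) k 𝔤) (i j : Fin n) :
    dx b i * dx b j + dx b j * dx b i = 0 := by
  rw [dx, dx, Algebra.TensorProduct.tmul_mul_tmul, Algebra.TensorProduct.tmul_mul_tmul,
    ← TensorProduct.add_tmul, ExteriorAlgebra.ι_add_mul_swap, TensorProduct.zero_tmul]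

theorem series_commute (ω : Forms k 𝔤 n) (f : MvPowerSeries (Fin n) k) :
    Commute ω (series k 𝔤 n f) := by
  induction ω using TensorProduct.induction_on with
  | zero => exact Commute.zero_left _
  | add a c ha hc => exact ha.add_left hc
  | tmul a g =>
    simp only [Commute, SemiconjBy, series, Algebra.TensorProduct.includeRight_apply,
      Algebra.TensorProduct.tmul_mul_tmul, mul_one, one_mul, mul_comm]

theorem tmul_eq_series (a : ExteriorAlgebra k 𝔤) (f : MvPowerSeries (Fin n) k) :
    (a ⊗ₜ[k] f : Forms k 𝔤 n) = (a ⊗ₜ[k] 1) * series k 𝔤 n f := by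
  simp [series]

theorem formsHom_ext (b : Module.Basis (Fin n) k 𝔤) {σ τ : Forms k 𝔤 n →ₐ[k] Forms k 𝔤 n}
    (h1 : ∀ f, σ (series k 𝔤 n f) = τ (series k 𝔤 n f)) (h2 : ∀ l, σ (dx b l) = τ (dx b l)) : σ = τ := by
  apply Algebra.TensorProduct.ext
  · apply ExteriorAlgebra.hom_ext
    exact b.ext h2
  · ext f
    exact h1 f

theorem lTensor_leibniz
    (D : Derivation k (MvPowerSeries (Fin n) k) (MvPowerSeries (Fin n) k)) (ω η : Forms k 𝔤 n) :
    LinearMap.lTensor (ExteriorAlgebra k 𝔤) D.toLinearMap (ω * η)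
      = LinearMap.lTensor (ExteriorAlgebra k 𝔤) D.toLinearMap ω * η
        + ω * LinearMap.lTensor (ExteriorAlgebra k 𝔤) D.toLinearMap η := by
  induction ω using TensorProduct.induction_on with
  | zero => simp
  | add a c ha hc => simp only [add_mul, map_add, ha, hc]; abel
  | tmul a f =>
    induction η using TensorProduct.induction_on with
    | zero => simp
    | add a' c' ha hc => simp only [mul_add, map_add, ha, hc]; abel
    | tmul a' f' =>
      simp only [Algebra.TensorProduct.tmul_mul_tmul, LinearMap.lTensor_tmul,
        Derivation.coeFn_coe, Derivation.leibniz, smul_eq_mul]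
      rw [← TensorProduct.tmul_add, add_comm, mul_comm f']

variable [CharZero k]

/-- The endomorphism of the `Ŝ(𝔤*)`-algebra `Λ(𝔤) ⊗ Ŝ(𝔤*)` with `dx̂ₗ ↦ ∑ dx̂ⱼ Nʲₗ`. -/
def substForms (b : Module.Basis (Fin n) k 𝔤)
    (N : Matrix (Fin n) (Fin n) (MvPowerSeries (Fin n) k)) : Forms k 𝔤 n →ₐ[k] Forms k 𝔤 n :=
  Algebra.TensorProduct.lift
    (ExteriorAlgebra.lift k
      ⟨b.constr k fun l => ∑ j, dx b j * series k 𝔤 n (N j l), fun m => by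
        set c : Fin n → MvPowerSeries (Fin n) k := fun j => ∑ l, b.repr m l • N j l
        have h : b.constr k (fun l => ∑ j, dx b j * series k 𝔤 n (N j l)) m
            = ∑ j, dx b j * series k 𝔤 n (c j) := by
          rw [Module.Basis.constr_apply_fintype]
          simp only [Finset.smul_sum, c, map_sum, map_smul, Finset.mul_sum, mul_smul_comm,
            Module.Basis.equivFun_apply]
          exact Finset.sum_comm
        rw [h]
        have hterm : ∀ i j, (dx b i * series k 𝔤 n (c i)) * (dx b j * series k 𝔤 n (c j))
            = (dx b i * dx b j) * series k 𝔤 n (c i * c j) := by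
          intro i j
          rw [map_mul, mul_assoc, ← mul_assoc (series k 𝔤 n (c i)),
            ← (series_commute (dx b j) (c i)).eq]
          simp only [mul_assoc]
        have h1 : (∑ j, dx b j * series k 𝔤 n (c j)) * (∑ j, dx b j * series k 𝔤 n (c j))
            = ∑ i, ∑ j, (dx b i * dx b j) * series k 𝔤 n (c i * c j) := by
          rw [Finset.sum_mul_sum]
          simp only [hterm]
        have h2 : (∑ i, ∑ j, (dx b i * dx b j) * series k 𝔤 n (c i * c j))
            = - ∑ i, ∑ j, (dx b i * dx b j) * series k 𝔤 n (c i * c j) := by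
          conv_lhs => rw [Finset.sum_comm]
          rw [← Finset.sum_neg_distrib]
          refine Finset.sum_congr rfl fun i _ => ?_
          rw [← Finset.sum_neg_distrib]
          refine Finset.sum_congr rfl fun j _ => ?_
          rw [mul_comm (c j)]
          exact eq_neg_of_add_eq_zero_left (by rw [← add_mul, dx_mul_dx, zero_mul])
        have h3 : (2 : k) • (∑ i, ∑ j, (dx b i * dx b j) * series k 𝔤 n (c i * c j)) = 0 := by
          rw [two_smul]
          nth_rewrite 1 [h2]
          exact neg_add_cancel _
        rw [h1]
        exact (smul_eq_zero.mp h3).resolve_left two_ne_zero⟩)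
    (series k 𝔤 n) (fun a f => series_commute _ f)

theorem substForms_series (b : Module.Basis (Fin n) k 𝔤)
    (N : Matrix (Fin n) (Fin n) (MvPowerSeries (Fin n) k)) (f : MvPowerSeries (Fin n) k) :
    substForms b N (series k 𝔤 n f) = series k 𝔤 n f := by
  simp [substForms, series]

theorem substForms_dx (b : Module.Basis (Fin n) k 𝔤)
    (N : Matrix (Fin n) (Fin n) (MvPowerSeries (Fin n) k)) (l : Fin n) :
    substForms b N (dx b l) = ∑ j, dx b j * series k 𝔤 n (N j l) := by
  simp [substForms, dx]

theorem substForms_comp (b : Module.Basis (Fin n) k 𝔤)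
    (N N' : Matrix (Fin n) (Fin n) (MvPowerSeries (Fin n) k)) (ω : Forms k 𝔤 n) :
    substForms b N (substForms b N' ω) = substForms b (N * N') ω := by
  have : (substForms b N).comp (substForms b N') = substForms b (N * N') := by
    apply formsHom_ext b
    · intro f; simp [substForms_series]
    · intro l
      simp only [AlgHom.comp_apply, substForms_dx, map_sum, map_mul, substForms_series,
        Matrix.mul_apply, Finset.sum_mul, Finset.mul_sum, mul_assoc]
      exact Finset.sum_comm
  exact DFunLike.congr_fun this ω

theorem substForms_one (b : Module.Basis (Fin n) k 𝔤) (ω : Forms k 𝔤 n) :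
    substForms b 1 ω = ω := by
  have : substForms b 1 = AlgHom.id k _ := by
    apply formsHom_ext b
    · intro f; simp [substForms_series]
    · intro l
      rw [substForms_dx, Finset.sum_eq_single l]
      · simp
      · intro j _ hj; simp [Matrix.one_apply_ne hj]
      · simp
  exact DFunLike.congr_fun this ω

theorem exists_unique_formExtension (b : Module.Basis (Fin n) k 𝔤)
    (φ : 𝔤 →ₗ⁅k⁆ Derivation k (MvPowerSeries (Fin n) k) (MvPowerSeries (Fin n) k))
    (hφ : IsUnit (phiMatrix b φ)) : ∃! ψ, IsFormExtension b φ ψ := by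
  set M := phiMatrix b φ with hM
  have hMM : M * M⁻¹ = 1 := Matrix.mul_nonsing_inv M ((Matrix.isUnit_iff_isUnit_det M).mp hφ)
  have hMM' : M⁻¹ * M = 1 := Matrix.nonsing_inv_mul M ((Matrix.isUnit_iff_isUnit_det M).mp hφ)
  let T : 𝔤 → Module.End k (Forms k 𝔤 n) := fun x =>
    LinearMap.lTensor (ExteriorAlgebra k 𝔤) (φ x).toLinearMap
  have hTadd : ∀ x y ω, T (x + y) ω = T x ω + T y ω := by
    intro x y ω
    induction ω using TensorProduct.induction_on with
    | zero => simp
    | add a c ha hc => simp only [map_add, ha, hc]; abel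
    | tmul a f => simp [T]
  have hTsmul : ∀ (r : k) x ω, T (r • x) ω = r • T x ω := by
    intro r x ω
    induction ω using TensorProduct.induction_on with
    | zero => simp
    | add a c ha hc => simp only [map_add, ha, hc, smul_add]
    | tmul a f => simp [T]
  have hTlie : ∀ x y ω, T ⁅x, y⁆ ω = T x (T y ω) - T y (T x ω) := by
    intro x y ω
    induction ω using TensorProduct.induction_on with
    | zero => simp
    | add a c ha hc => simp only [map_add, ha, hc]; abel
    | tmul a f =>
      change a ⊗ₜ[k] (φ ⁅x, y⁆ f) = a ⊗ₜ[k] (φ x (φ y f)) - a ⊗ₜ[k] (φ y (φ x f))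
      rw [LieHom.map_lie, Derivation.commutator_apply, TensorProduct.tmul_sub]
  let ψ : 𝔤 →ₗ⁅k⁆ Der k (Forms k 𝔤 n) :=
    { toFun := fun x =>
        ⟨(substForms b M⁻¹).toLinearMap ∘ₗ T x ∘ₗ (substForms b M).toLinearMap, fun ω η => by
          simp only [LinearMap.comp_apply, AlgHom.toLinearMap_apply, map_mul]
          rw [lTensor_leibniz, map_add, map_mul, map_mul, substForms_comp, substForms_comp, hMM',
            substForms_one, substForms_one]⟩
      map_add' := fun x y => Subtype.ext (LinearMap.ext fun ω => by
        simp [hTadd])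
      map_smul' := fun r x => Subtype.ext (LinearMap.ext fun ω => by
        simp [hTsmul])
      map_lie' := fun {x y} => Subtype.ext (LinearMap.ext fun ω => by
        simp [hTlie, LieRing.of_associative_ring_bracket, substForms_comp, hMM, substForms_one]) }
  have hψ : ∀ x ω, (ψ x : Module.End k (Forms k 𝔤 n)) ω
      = substForms b M⁻¹ (T x (substForms b M ω)) := fun x ω => rfl
  have hT : ∀ x j f, T x (dx b j * series k 𝔤 n f) = dx b j * series k 𝔤 n (φ x f) := by
    intro x j f
    rw [dx, ← tmul_eq_series, ← tmul_eq_series]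
    rfl
  have hE : IsFormExtension b φ ψ := ⟨fun x f => ?_, fun i l => ?_⟩
  · refine ⟨ψ, hE, fun ψ' h' => ?_⟩
    have hdx : ∀ i l, (ψ' (b i) : Module.End k (Forms k 𝔤 n)) (dx b l)
        = (ψ (b i) : Module.End k (Forms k 𝔤 n)) (dx b l) := by
      intro i l
      have h := (h'.apply_dx i l).trans (hE.apply_dx i l).symm
      rw [map_neg, map_neg] at h
      exact neg_injective h
    have hι : ∀ x m, (ψ' x : Module.End k (Forms k 𝔤 n)) (ExteriorAlgebra.ι k m ⊗ₜ[k] 1)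
        = (ψ x : Module.End k (Forms k 𝔤 n)) (ExteriorAlgebra.ι k m ⊗ₜ[k] 1) := by
      let j : 𝔤 →ₗ[k] Forms k 𝔤 n :=
        (TensorProduct.mk k (ExteriorAlgebra k 𝔤) (MvPowerSeries (Fin n) k)).flip 1 ∘ₗ
          ExteriorAlgebra.ι k
      let F : (𝔤 →ₗ⁅k⁆ Der k (Forms k 𝔤 n)) → 𝔤 →ₗ[k] 𝔤 →ₗ[k] Forms k 𝔤 n := fun χ =>
        (LinearMap.lcomp k (Forms k 𝔤 n) j) ∘ₗ (Der k (Forms k 𝔤 n)).toSubmodule.subtype ∘ₗ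
          (χ : 𝔤 →ₗ[k] Der k (Forms k 𝔤 n))
      have : F ψ' = F ψ := b.ext fun i => b.ext fun l => hdx i l
      intro x m
      exact DFunLike.congr_fun (DFunLike.congr_fun this x) m
    have hΛ : ∀ x (a : ExteriorAlgebra k 𝔤), (ψ' x : Module.End k (Forms k 𝔤 n)) (a ⊗ₜ[k] 1)
        = (ψ x : Module.End k (Forms k 𝔤 n)) (a ⊗ₜ[k] 1) := by
      intro x a
      induction a using ExteriorAlgebra.induction with
      | algebraMap r =>
        have hr : ((algebraMap k (ExteriorAlgebra k 𝔤) r) ⊗ₜ[k] 1 : Forms k 𝔤 n)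
            = series k 𝔤 n (algebraMap k _ r) := by
          rw [AlgHom.commutes]; rfl
        rw [hr, h'.apply_series, hE.apply_series]
      | ι m => exact hι x m
      | mul a c ha hc =>
        have hac : ((a * c) ⊗ₜ[k] 1 : Forms k 𝔤 n) = (a ⊗ₜ[k] 1) * (c ⊗ₜ[k] 1) := by simp
        rw [hac, (ψ' x).2, (ψ x).2, ha, hc]
      | add a c ha hc => rw [TensorProduct.add_tmul, map_add, map_add, ha, hc]
    refine LieHom.ext fun x => Subtype.ext (LinearMap.ext fun ω => ?_)
    induction ω using TensorProduct.induction_on with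
    | zero => rw [map_zero, map_zero]
    | add a c ha hc => rw [map_add, map_add, ha, hc]
    | tmul a f =>
      rw [tmul_eq_series, (ψ' x).2, (ψ x).2, hΛ, h'.apply_series, hE.apply_series]
  · rw [hψ, substForms_series]
    have : T x (series k 𝔤 n f) = series k 𝔤 n (φ x f) := rfl
    rw [this, substForms_series]
  · rw [hψ, substForms_dx, map_sum, map_sum]
    simp only [hT, map_mul, substForms_dx, substForms_series]
    have hch : ∀ f, φ (-(b i)) f = ∑ r, MvPowerSeries.pderiv k r f * M r i :=
      fun f => derivation_apply (φ (-(b i))) f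
    simp only [hch, map_sum, Finset.sum_mul, Finset.mul_sum, map_mul, mul_assoc]
    rw [Finset.sum_comm' (t' := Finset.univ) (s' := fun _ => Finset.univ) (by simp)]
    refine (Finset.sum_congr rfl fun r _ => Finset.sum_comm).trans ?_
    exact Finset.sum_comm

/-- The unique extension of `φ` to an action of `𝔤` on `Λ(𝔤) ⊗ Ŝ(𝔤*)` as in
`IsFormExtension`. -/
def formExtension (b : Module.Basis (Fin n) k 𝔤)
    (φ : 𝔤 →ₗ⁅k⁆ Derivation k (MvPowerSeries (Fin n) k) (MvPowerSeries (Fin n) k))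
    (hφ : IsUnit (phiMatrix b φ)) : 𝔤 →ₗ⁅k⁆ Der k (Forms k 𝔤 n) :=
  (exists_unique_formExtension b φ hφ).choose

theorem formExtension_spec (b : Module.Basis (Fin n) k 𝔤)
    (φ : 𝔤 →ₗ⁅k⁆ Derivation k (MvPowerSeries (Fin n) k) (MvPowerSeries (Fin n) k))
    (hφ : IsUnit (phiMatrix b φ)) : IsFormExtension b φ (formExtension b φ hφ) :=
  (exists_unique_formExtension b φ hφ).choose_spec.1

end Forms

/-! ### The extended algebra of twisted differential forms and its presentation -/

section Presentation

variable {k : Type u} [Field k] {𝔤 : Type v} [LieRing 𝔤] [LieAlgebra k 𝔤] {n : ℕ}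

/-- The defining relations, for elements `X i`, `Y i`, `P i` of an algebra `B` in the roles of
`x̂ᵢ`, `dx̂ᵢ`, `∂ⁱ`. The algebra map `e` evaluates formal power series at `∂ⁱ = P i`; it gives a
meaning in `B` to the power series on the right-hand sides. -/
structure TwistedRelations (b : Module.Basis (Fin n) k 𝔤)
    (φ : 𝔤 →ₗ⁅k⁆ Derivation k (MvPowerSeries (Fin n) k) (MvPowerSeries (Fin n) k))
    {B : Type w} [Ring B] [Algebra k B] (e : MvPowerSeries (Fin n) k →ₐ[k] B)
    (X Y P : Fin n → B) : Prop where
  x_x : ∀ i j, X i * X j - X j * X i = ∑ l, b.repr ⁅b i, b j⁆ l • X l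
  p_p : ∀ i j, P i * P j - P j * P i = 0
  p_x : ∀ i j, P j * X i - X i * P j = e (phiMatrix b φ j i)
  p_dx : ∀ i j, P j * Y i - Y i * P j = 0
  dx_x : ∀ i j, Y i * X j - X j * Y i =
    ∑ s, ∑ r, ∑ l, Y s * e ((phiMatrix b φ)⁻¹ s r *
      MvPowerSeries.pderiv k l (phiMatrix b φ r i) * phiMatrix b φ l j)
  dx_dx : ∀ i j, Y i * Y j + Y j * Y i = 0

/-- The usual topology of `k[[∂¹, …, ∂ⁿ]]`: coefficientwise convergence, `k` being discrete. -/
abbrev seriesTopology (k : Type u) [Field k] (n : ℕ) : TopologicalSpace (MvPowerSeries (Fin n) k) :=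
  @MvPowerSeries.WithPiTopology.instTopologicalSpace (Fin n) k ⊥

variable [CharZero k]

/-- The extended algebra of `φ`-twisted differential forms
`U(𝔤) ♯ (Λ(𝔤) ⊗ Ŝ(𝔤*))`. -/
abbrev ExtendedForms (b : Module.Basis (Fin n) k 𝔤)
    (φ : 𝔤 →ₗ⁅k⁆ Derivation k (MvPowerSeries (Fin n) k) (MvPowerSeries (Fin n) k))
    (hφ : IsUnit (phiMatrix b φ)) : Type (max u v) :=
  SmashProduct (formExtension b φ hφ)

namespace ExtendedForms

variable (b : Module.Basis (Fin n) k 𝔤)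
    (φ : 𝔤 →ₗ⁅k⁆ Derivation k (MvPowerSeries (Fin n) k) (MvPowerSeries (Fin n) k))
    (hφ : IsUnit (phiMatrix b φ))

/-- The generator `x̂ᵢ = x̂ᵢ ⊗ 1`. -/
def xHat (i : Fin n) : ExtendedForms b φ hφ :=
  SmashProduct.mk _ (UniversalEnvelopingAlgebra.ι k (b i)) 1

/-- The generator `dx̂ᵢ = 1 ⊗ dx̂ᵢ`. -/
def dxHat (i : Fin n) : ExtendedForms b φ hφ :=
  SmashProduct.inclRight _ (dx b i)

/-- The inclusion of `Ŝ(𝔤*)`. -/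
def ofSeries : MvPowerSeries (Fin n) k →ₐ[k] ExtendedForms b φ hφ :=
  (SmashProduct.inclRight _).comp (series k 𝔤 n)

/-- The generator `∂ⁱ`. -/
def partialGen (i : Fin n) : ExtendedForms b φ hφ :=
  ofSeries b φ hφ (MvPowerSeries.X i)

/-- The left ideal generated by the power series of order at least `N`, that is by the `N`-th power
of the ideal `(∂¹, …, ∂ⁿ)`. -/
def orderIdeal (N : ℕ) : Ideal (ExtendedForms b φ hφ) :=
  Ideal.span (ofSeries b φ hφ ''
    ((RingHom.ker (MvPowerSeries.constantCoeff (σ := Fin n) (R := k)) ^ N :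
      Ideal (MvPowerSeries (Fin n) k)) : Set (MvPowerSeries (Fin n) k)))

theorem orderIdeal_anti {M N : ℕ} (h : M ≤ N) :
    orderIdeal b φ hφ N ≤ orderIdeal b φ hφ M :=
  Ideal.span_mono (Set.image_mono (Ideal.pow_le_pow_right h))

/-- The `∂`-adic topology: the cosets `a + orderIdeal N` are a neighbourhood basis of `a`. -/
instance : TopologicalSpace (ExtendedForms b φ hφ) where
  IsOpen s := ∀ a ∈ s, ∃ N, ∀ c ∈ orderIdeal b φ hφ N, a + c ∈ s
  isOpen_univ := fun _ _ => ⟨0, fun _ _ => trivial⟩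
  isOpen_inter := fun s t hs ht a ha => by
    obtain ⟨N, hN⟩ := hs a ha.1
    obtain ⟨M, hM⟩ := ht a ha.2
    exact ⟨max N M, fun c hc => ⟨hN c (orderIdeal_anti b φ hφ (le_max_left N M) hc),
      hM c (orderIdeal_anti b φ hφ (le_max_right N M) hc)⟩⟩
  isOpen_sUnion := fun S hS a ⟨t, ht, ha⟩ => by
    obtain ⟨N, hN⟩ := hS t ht a ha
    exact ⟨N, fun c hc => ⟨t, ht, hN c hc⟩⟩

end ExtendedForms

end Presentation

end TwistedForms

end

open TwistedForms TwistedForms.ExtendedForms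

/-! As a vector space `E` is `U(𝔤) ⊗ Λ(𝔤) ⊗ Ŝ(𝔤*)`, and its product is governed by one cross
relation: `a x = x a - ψ(x)(a)` for `x ∈ 𝔤`, `a ∈ Λ(𝔤) ⊗ Ŝ(𝔤*)`, with `ψ` the extended action
(`SmashProduct.inclRight_mul_ofLie`). The relations that involve `x̂ⱼ` and a form or a series are
instances of it; the others hold inside `U(𝔤)` or inside the algebra of forms.

The topology rests on one estimate. By the chain rule a derivation of power series lowers the order
by at most one (`derivation_mem_pow`), so it is automatically continuous. In `E`, moving a series
past `x̂` therefore loses at most one order, while forms commute with series. Hence right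
multiplications respect the left ideals `E 𝔪^N` up to a shift, and `E` is a topological ring. It is
Hausdorff because it is a free right `Ŝ(𝔤*)`-module and the powers `𝔪^N` intersect in zero.

For the universal property, the `Xᵢ` give a map on `U(𝔤)`, and the `Yᵢ` together with `e` give a map
on the forms. The relations prescribe commutators with the `Pᵢ` only; they extend from polynomials
to all series by density, continuity of `e` and of derivations, and the Hausdorff property of `B`.
The two maps then satisfy the cross relation (`formsHom_mul_lieHom`), which is all that is needed to
glue them into a homomorphism on `E`. -/

noncomputable section

namespace TwistedForms

/-! ### Powers of the ideal of power series without constant term -/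

section Series

variable {k : Type u} [Field k] {n : ℕ}

/-- The ideal `𝔪 = (∂¹, …, ∂ⁿ)` of power series without constant term. -/
abbrev seriesIdeal (k : Type u) [Field k] (n : ℕ) : Ideal (MvPowerSeries (Fin n) k) :=
  RingHom.ker (MvPowerSeries.constantCoeff (σ := Fin n) (R := k))

theorem X_mem_seriesIdeal (i : Fin n) : MvPowerSeries.X i ∈ seriesIdeal k n := by
  simp [RingHom.mem_ker]

/-- Writing `f = c + ∑ gᵢ Xᵢ` and approximating each `gᵢ` to order `N` approximates `f` to order `N
+ 1`, since each `Xᵢ` contributes one further factor from the ideal. -/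
theorem exists_polynomial_sub_mem (N : ℕ) (f : MvPowerSeries (Fin n) k) :
    ∃ p : MvPolynomial (Fin n) k, f - (p : MvPowerSeries (Fin n) k) ∈ seriesIdeal k n ^ N := by
  induction N generalizing f with
  | zero => exact ⟨0, by simp⟩
  | succ N ih =>
    obtain ⟨g, hg⟩ := exists_eq_C_add_sum_X_mul f
    choose p hp using fun i => ih (g i)
    refine ⟨MvPolynomial.C (MvPowerSeries.constantCoeff f) + ∑ i, p i * MvPolynomial.X i, ?_⟩
    have hsum : ((∑ i, p i * MvPolynomial.X i : MvPolynomial (Fin n) k) : MvPowerSeries (Fin n) k)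
        = ∑ i, (p i : MvPowerSeries (Fin n) k) * MvPowerSeries.X i := by
      rw [← MvPolynomial.coeToMvPowerSeries.ringHom_apply, map_sum]
      simp
    have h : f - ((MvPolynomial.C (MvPowerSeries.constantCoeff f) + ∑ i, p i * MvPolynomial.X i :
        MvPolynomial (Fin n) k) : MvPowerSeries (Fin n) k)
        = ∑ i, (g i - (p i : MvPowerSeries (Fin n) k)) * MvPowerSeries.X i := by
      rw [MvPolynomial.coe_add, hsum, MvPolynomial.coe_C]
      conv_lhs => rw [hg]
      simp [sub_mul, Finset.sum_sub_distrib]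
    rw [h, pow_succ]
    exact Ideal.sum_mem _ fun i _ => Ideal.mul_mem_mul (hp i) (X_mem_seriesIdeal i)

/-- In a product of an element of `𝔪^N` with one of `𝔪`, each term of a coefficient either contains
the vanishing constant coefficient of the second factor or leaves a strictly smaller degree for the
first. -/
theorem coeff_eq_zero_of_mem_pow {N : ℕ} {f : MvPowerSeries (Fin n) k}
    (hf : f ∈ seriesIdeal k n ^ N) {d : Fin n →₀ ℕ} (hd : d.degree < N) :
    MvPowerSeries.coeff d f = 0 := by
  induction N generalizing f d with
  | zero => omega
  | succ N ih =>
    rw [pow_succ] at hf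
    refine Submodule.mul_induction_on (C := fun f => MvPowerSeries.coeff d f = 0) hf ?_ ?_
    · intro g hg h hh
      classical
      rw [MvPowerSeries.coeff_mul]
      refine Finset.sum_eq_zero fun p hp => ?_
      rw [Finset.HasAntidiagonal.mem_antidiagonal] at hp
      by_cases h0 : p.2 = 0
      · have h1 : MvPowerSeries.constantCoeff h = 0 := hh
        rw [h0, MvPowerSeries.coeff_zero_eq_constantCoeff_apply, h1, mul_zero]
      · have h1 : p.2.degree ≠ 0 := fun h => h0 ((Finsupp.degree_eq_zero_iff _).mp h)
        have h2 : p.1.degree + p.2.degree = d.degree := by rw [← map_add, hp]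
        rw [ih hg (by omega), zero_mul]
    · intro g h hg hh
      rw [map_add, hg, hh, add_zero]

theorem monomial_mem_pow {N : ℕ} {d : Fin n →₀ ℕ} (hd : N ≤ d.degree) (c : k) :
    MvPowerSeries.monomial d c ∈ seriesIdeal k n ^ N := by
  have h : MvPowerSeries.monomial d c
      = MvPowerSeries.C c * ∏ i, (MvPowerSeries.X i : MvPowerSeries (Fin n) k) ^ d i := by
    -- The factorisation of a monomial into variables is carried over from polynomials.
    have h1 := congrArg (fun p : MvPolynomial (Fin n) k => (p : MvPowerSeries (Fin n) k))
      (MvPolynomial.monomial_eq (s := d) (a := c))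
    rw [Finsupp.prod_fintype _ _ (fun i => pow_zero _)] at h1
    simp only [MvPolynomial.coe_monomial, MvPolynomial.coe_mul, MvPolynomial.coe_C] at h1
    rw [h1, ← MvPolynomial.coeToMvPowerSeries.ringHom_apply, map_prod]
    simp
  rw [h]
  refine Ideal.mul_mem_left _ _ (Ideal.pow_le_pow_right hd ?_)
  rw [Finsupp.degree_eq_sum, ← Finset.prod_pow_eq_pow_sum]
  exact Ideal.prod_mem_prod fun i _ => Ideal.pow_mem_pow (X_mem_seriesIdeal i) _

/-- For the converse, a series has infinitely many terms and is not a finite sum of monomials.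
Removing a part already known to lie in `𝔪^N` leaves a polynomial, whose finitely many monomials can
be treated one by one. -/
theorem mem_seriesIdeal_pow_iff {N : ℕ} {f : MvPowerSeries (Fin n) k} :
    f ∈ seriesIdeal k n ^ N ↔
      ∀ d : Fin n →₀ ℕ, d.degree < N → MvPowerSeries.coeff d f = 0 := by
  refine ⟨fun hf d hd => coeff_eq_zero_of_mem_pow hf hd, fun hf => ?_⟩
  obtain ⟨p, hp⟩ := exists_polynomial_sub_mem N f
  rw [← sub_add_cancel f (p : MvPowerSeries (Fin n) k)]
  refine Ideal.add_mem _ hp ?_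
  have hsum : (p : MvPowerSeries (Fin n) k)
      = ∑ d ∈ p.support, MvPowerSeries.monomial d (MvPolynomial.coeff d p) := by
    conv_lhs => rw [MvPolynomial.as_sum p]
    rw [← MvPolynomial.coeToMvPowerSeries.ringHom_apply, map_sum]
    simp
  rw [hsum]
  refine Ideal.sum_mem _ fun d hd => monomial_mem_pow ?_ _
  -- In degrees below `N` the polynomial has the same coefficients as `f`, namely zero, so its
  -- support avoids these degrees.
  by_contra! h
  have h1 := coeff_eq_zero_of_mem_pow hp h
  rw [map_sub, hf d h, zero_sub, neg_eq_zero, MvPolynomial.coeff_coe] at h1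
  exact MvPolynomial.mem_support_iff.mp hd h1

/-- In the chain rule each `∂ᵣ f` loses one order, and the factor `D Xᵣ` may be a unit, so nothing
is regained in general. -/
theorem derivation_mem_pow (D : Derivation k (MvPowerSeries (Fin n) k) (MvPowerSeries (Fin n) k))
    {N : ℕ} {f : MvPowerSeries (Fin n) k} (hf : f ∈ seriesIdeal k n ^ (N + 1)) :
    D f ∈ seriesIdeal k n ^ N := by
  rw [derivation_apply]
  refine Ideal.sum_mem _ fun r _ => Ideal.mul_mem_right _ _ ?_
  rw [mem_seriesIdeal_pow_iff] at hf ⊢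
  intro d hd
  rw [MvPowerSeries.coeff_pderiv, hf _ (by rw [map_add, Finsupp.degree_single]; omega), zero_mul]

/-! ### Coefficientwise convergence is the `𝔪`-adic topology -/

theorem hasBasis_nhds_zero_series :
    (@nhds _ (seriesTopology k n) 0).HasBasis (fun _ : ℕ => True)
      fun N => (seriesIdeal k n ^ N : Ideal (MvPowerSeries (Fin n) k)) := by
  let : TopologicalSpace k := ⊥
  have : DiscreteTopology k := ⟨rfl⟩
  let := seriesTopology k n
  refine ⟨fun s => ⟨fun hs => ?_, fun ⟨N, _, hN⟩ => Filter.mem_of_superset ?_ hN⟩⟩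
  · have hs' : (show Set ((Fin n →₀ ℕ) → k) from s) ∈ Filter.pi fun _ => 𝓝 (0 : k) := by
      have h := nhds_pi (a := (0 : (Fin n →₀ ℕ) → k))
      exact h.ge hs
    obtain ⟨I, hI, t, ht, hts⟩ := Filter.mem_pi.mp hs'
    -- A basic neighbourhood constrains finitely many coefficients. If `N` bounds their degrees,
    -- `𝔪^(N+1)` kills them all, those of degree `N` included.
    obtain ⟨N, hN⟩ := (hI.image Finsupp.degree).bddAbove
    refine ⟨N + 1, trivial, fun f hf => hts fun d hd => ?_⟩
    have h1 : MvPowerSeries.coeff d f = 0 :=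
      coeff_eq_zero_of_mem_pow hf (Nat.lt_succ_of_le (hN ⟨d, hd, rfl⟩))
    have h2 : f d = 0 := h1
    rw [h2]
    exact mem_of_mem_nhds (ht d)
  -- With finitely many variables, membership in `𝔪^N` is a finite set of coefficient conditions,
  -- hence an open one.
  · have hfin : {d : Fin n →₀ ℕ | d.degree < N}.Finite := 
      (Finsupp.finite_of_degree_le N).subset fun d (hd : d.degree < N) => hd.le
    have h : ∀ d ∈ {d : Fin n →₀ ℕ | d.degree < N},
        {f : MvPowerSeries (Fin n) k | MvPowerSeries.coeff d f = 0} ∈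
          𝓝 (0 : MvPowerSeries (Fin n) k) := fun d _ =>
      (MvPowerSeries.WithPiTopology.continuous_coeff k d).continuousAt.preimage_mem_nhds
        (by rw [map_zero]; exact (isOpen_discrete {(0 : k)}).mem_nhds rfl)
    refine Filter.mem_of_superset ((Filter.biInter_mem hfin).mpr h) fun f hf => ?_
    rw [SetLike.mem_coe, mem_seriesIdeal_pow_iff]
    intro d hd
    exact Set.mem_iInter₂.mp hf d hd

theorem isTopologicalRing_series :
    @IsTopologicalRing (MvPowerSeries (Fin n) k) (seriesTopology k n) _ := by
  let : TopologicalSpace k := ⊥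
  have : DiscreteTopology k := ⟨rfl⟩
  exact MvPowerSeries.WithPiTopology.instIsTopologicalRing _ _

theorem denseRange_polynomial :
    @DenseRange _ (seriesTopology k n) _
      (fun p : MvPolynomial (Fin n) k => (p : MvPowerSeries (Fin n) k)) := by
  let : TopologicalSpace k := ⊥
  exact MvPowerSeries.WithPiTopology.denseRange_toMvPowerSeries

theorem continuous_derivation
    (D : Derivation k (MvPowerSeries (Fin n) k) (MvPowerSeries (Fin n) k)) :
    Continuous[seriesTopology k n, seriesTopology k n] D := by
  let := seriesTopology k n
  have := isTopologicalRing_series (k := k) (n := n)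
  refine continuous_of_continuousAt_zero D ?_
  rw [ContinuousAt, map_zero]
  refine (hasBasis_nhds_zero_series.tendsto_iff hasBasis_nhds_zero_series).mpr fun N _ =>
    ⟨N + 1, trivial, fun f hf => derivation_mem_pow D hf⟩

/-- The algebraic half of the density arguments: it is applied to the subalgebra generated by the
symbols and to the centralizer of `Yᵢ`. -/
theorem polynomial_mem {B : Type*} [Ring B] [Algebra k B] (e : MvPowerSeries (Fin n) k →ₐ[k] B)
    (S : Subalgebra k B) (h : ∀ i, e (MvPowerSeries.X i) ∈ S) (p : MvPolynomial (Fin n) k) :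
    e p ∈ S := by
  induction p using MvPolynomial.induction_on with
  | C r =>
    rw [MvPolynomial.coe_C]
    have : (MvPowerSeries.C r : MvPowerSeries (Fin n) k) = algebraMap k _ r := rfl
    rw [this, AlgHom.commutes]
    exact S.algebraMap_mem r
  | add p q hp hq => rw [MvPolynomial.coe_add, map_add]; exact add_mem hp hq
  | mul_X p i hp =>
    rw [MvPolynomial.coe_mul, map_mul, MvPolynomial.coe_X]
    exact mul_mem hp (h i)

end Series

/-! ### Generators and universal property of the smash product -/

namespace SmashProduct

variable {k : Type u} [CommRing k] {𝔤 : Type v} [LieRing 𝔤] [LieAlgebra k 𝔤]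
  {A : Type w} [Ring A] [Algebra k A] (ψ : 𝔤 →ₗ⁅k⁆ Der k A)

local notation "U" => UniversalEnvelopingAlgebra k 𝔤

/-- The element `x ⊗ 1` for `x ∈ 𝔤`, as a linear map. -/
def ofLie : 𝔤 →ₗ[k] SmashProduct ψ :=
  (TensorProduct.mk k U A).flip 1 ∘ₗ (UniversalEnvelopingAlgebra.ι k : 𝔤 →ₗ⁅k⁆ U)

theorem ofLie_apply (x : 𝔤) : ofLie ψ x = mk ψ (UniversalEnvelopingAlgebra.ι k x) 1 := rfl

theorem mk_mul_inclRight (u : U) (a c : A) : mk ψ u a * inclRight ψ c = mk ψ u (a * c) := by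
  change smashRight ψ ((1 : U) ⊗ₜ[k] c) (u ⊗ₜ[k] a) = u ⊗ₜ[k] (a * c)
  rw [smashRight_tmul, diagonalRight_comul_one]
  simp

/-- Since `Δ x = x ⊗ 1 + 1 ⊗ x`, there are two terms; the minus sign comes from the antipode. -/
theorem mk_mul_ofLie (u : U) (a : A) (x : 𝔤) :
    mk ψ u a * ofLie ψ x = mk ψ (u * UniversalEnvelopingAlgebra.ι k x) a
      - mk ψ u ((ψ x : Module.End k A) a) := by
  change smashRight ψ (UniversalEnvelopingAlgebra.ι k x ⊗ₜ[k] (1 : A)) (u ⊗ₜ[k] a)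
    = (u * UniversalEnvelopingAlgebra.ι k x) ⊗ₜ[k] a - u ⊗ₜ[k] ((ψ x : Module.End k A) a)
  rw [smashRight_tmul, LinearMap.comp_apply, diagonalRight_comul_ι]
  simp

theorem inclRight_apply (a : A) : inclRight ψ a = mk ψ 1 a := rfl

theorem derivation_one (x : 𝔤) : (ψ x : Module.End k A) 1 = 0 := by
  have := (ψ x).2 1 1
  simpa using this

theorem inclRight_mul_ofLie (x : 𝔤) (a : A) :
    inclRight ψ a * ofLie ψ x
      = ofLie ψ x * inclRight ψ a - inclRight ψ ((ψ x : Module.End k A) a) := by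
  rw [ofLie_apply, mk_mul_inclRight, ← ofLie_apply, inclRight_apply, mk_mul_ofLie, one_mul, one_mul,
    inclRight_apply]

/-- Derivations kill `1`, so no correction terms arise and `U(𝔤) ⊗ 1` is a copy of `U(𝔤)`. -/
theorem mk_mul_mk_one (u v : U) : mk ψ u 1 * mk ψ v 1 = mk ψ (u * v) 1 := by
  induction v using enveloping_induction generalizing u with
  | hc r =>
    have h : ∀ w : U, mk ψ (w * algebraMap k U r) 1 = r • mk ψ w 1 := fun w => by
      rw [← Algebra.commutes, ← Algebra.smul_def]; exact TensorProduct.smul_tmul' r w (1 : A)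
    rw [h, ← one_mul (algebraMap k U r), h, mul_smul_comm]
    exact congrArg (r • ·) (mul_one (mk ψ u 1))
  | hx x =>
    rw [← ofLie_apply, mk_mul_ofLie, derivation_one]
    exact (congrArg _ (TensorProduct.tmul_zero A u)).trans (sub_zero _)
  | hmul a c ha hc => rw [← hc a, ← mul_assoc, ha, hc, mul_assoc]
  | hadd a c ha hc =>
    have h : ∀ w w' : U, mk ψ (w + w') 1 = mk ψ w 1 + mk ψ w' 1 := fun w w' =>
      TensorProduct.add_tmul w w' (1 : A)
    rw [h, mul_add, mul_add, h, ha, hc]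

theorem mk_eq_mul (u : U) (a : A) : mk ψ u a = mk ψ u 1 * inclRight ψ a := by
  rw [mk_mul_inclRight, one_mul]

variable {ψ} in
theorem induction_mk {C : SmashProduct ψ → Prop} (zero : C 0) (mk : ∀ u a, C (mk ψ u a))
    (add : ∀ s t, C s → C t → C (s + t)) (s : SmashProduct ψ) : C s :=
  TensorProduct.induction_on (motive := C) s zero mk add

variable {ψ} in
/-- The smash product is generated by `𝔤` and `A`. -/
theorem induction_generators {C : SmashProduct ψ → Prop} (hx : ∀ x, C (ofLie ψ x))
    (ha : ∀ a, C (inclRight ψ a)) (hmul : ∀ s t, C s → C t → C (s * t))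
    (hadd : ∀ s t, C s → C t → C (s + t)) (s : SmashProduct ψ) : C s := by
  have hu : ∀ u : U, C (mk ψ u 1) := fun u => by
    induction u using enveloping_induction with
    | hc r =>
      have h : mk ψ (algebraMap k U r) 1 = inclRight ψ (algebraMap k A r) := by
        rw [AlgHom.commutes, Algebra.algebraMap_eq_smul_one, Algebra.algebraMap_eq_smul_one]
        exact (TensorProduct.smul_tmul' r (1 : U) (1 : A)).symm
      rw [h]
      exact ha _
    | hx x => exact hx x
    | hmul a c h h' => rw [← mk_mul_mk_one]; exact hmul _ _ h h'
    | hadd a c h h' =>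
      have : mk ψ (a + c) 1 = mk ψ a 1 + mk ψ c 1 := TensorProduct.add_tmul a c (1 : A)
      rw [this]; exact hadd _ _ h h'
  induction s using induction_mk with
  | zero => rw [← map_zero (inclRight ψ)]; exact ha 0
  | mk u a => rw [mk_eq_mul]; exact hmul _ _ (hu u) (ha a)
  | add s t hs ht => exact hadd s t hs ht

/-! ### Gluing homomorphisms on the two factors -/

section Lift

variable {B : Type*} [Ring B] [Algebra k B]

/-- The linear map `u ⊗ a ↦ f(u) g(a)`. -/
def liftLinear (f : U →ₐ[k] B) (g : A →ₐ[k] B) : SmashProduct ψ →ₗ[k] B :=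
  TensorProduct.lift ((LinearMap.mul k B).compl₁₂ f.toLinearMap g.toLinearMap)

theorem liftLinear_mk (f : U →ₐ[k] B) (g : A →ₐ[k] B) (u : U) (a : A) :
    liftLinear ψ f g (mk ψ u a) = f u * g a :=
  TensorProduct.lift.tmul u a

variable {ψ} in
-- By associativity, the right factors `t` for which this holds for every `s` are closed under
-- products. It is enough to take `t` in `𝔤` or in `A`, where the product with a pure tensor is
-- explicit.
theorem liftLinear_mul {f : U →ₐ[k] B} {g : A →ₐ[k] B}
    (h : ∀ x a, g a * f (UniversalEnvelopingAlgebra.ι k x)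
      = f (UniversalEnvelopingAlgebra.ι k x) * g a - g ((ψ x : Module.End k A) a))
    (s t : SmashProduct ψ) :
    liftLinear ψ f g (s * t) = liftLinear ψ f g s * liftLinear ψ f g t := by
  induction t using induction_generators generalizing s with
  | hx x =>
    induction s using induction_mk with
    | zero => rw [zero_mul, map_zero, zero_mul]
    | mk u a =>
      rw [mk_mul_ofLie, map_sub, ofLie_apply, liftLinear_mk, liftLinear_mk, liftLinear_mk,
        liftLinear_mk, map_mul, map_one, mul_one, mul_assoc (f u) (g a), h, mul_sub, mul_assoc]
    | add s s' hs hs' => rw [add_mul, map_add, map_add, hs, hs', add_mul]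
  | ha c =>
    induction s using induction_mk with
    | zero => rw [zero_mul, map_zero, zero_mul]
    | mk u a =>
      rw [mk_mul_inclRight, inclRight_apply, liftLinear_mk, liftLinear_mk, liftLinear_mk,
        map_mul, map_one, one_mul, mul_assoc]
    | add s s' hs hs' => rw [add_mul, map_add, map_add, hs, hs', add_mul]
  | hmul t t' ht ht' => rw [← mul_assoc, ht', ht, ht', mul_assoc]
  | hadd t t' ht ht' => rw [mul_add, map_add, map_add, ht, ht', mul_add]

variable {ψ} in
/-- Compatible algebra maps on `U(𝔤)` and on `A` extend to the smash product. -/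
def lift (f : U →ₐ[k] B) (g : A →ₐ[k] B)
    (h : ∀ x a, g a * f (UniversalEnvelopingAlgebra.ι k x)
      = f (UniversalEnvelopingAlgebra.ι k x) * g a - g ((ψ x : Module.End k A) a)) :
    SmashProduct ψ →ₐ[k] B :=
  AlgHom.ofLinearMap (liftLinear ψ f g)
    ((liftLinear_mk ψ f g 1 1).trans (by rw [map_one, map_one, one_mul]))
    (liftLinear_mul h)

theorem lift_ofLie {f : U →ₐ[k] B} {g : A →ₐ[k] B}
    (h : ∀ x a, g a * f (UniversalEnvelopingAlgebra.ι k x)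
      = f (UniversalEnvelopingAlgebra.ι k x) * g a - g ((ψ x : Module.End k A) a))
    (x : 𝔤) :
    lift f g h (ofLie ψ x) = f (UniversalEnvelopingAlgebra.ι k x) := by
  change liftLinear ψ f g (mk ψ (UniversalEnvelopingAlgebra.ι k x) 1) = _
  rw [liftLinear_mk, map_one, mul_one]

theorem lift_inclRight {f : U →ₐ[k] B} {g : A →ₐ[k] B}
    (h : ∀ x a, g a * f (UniversalEnvelopingAlgebra.ι k x)
      = f (UniversalEnvelopingAlgebra.ι k x) * g a - g ((ψ x : Module.End k A) a))
    (a : A) :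
    lift f g h (inclRight ψ a) = g a := by
  change liftLinear ψ f g (mk ψ 1 a) = _
  rw [liftLinear_mk, map_one, one_mul]

end Lift

end SmashProduct

/-! ### Topology and generators of the extended algebra -/

section Forms

variable {k : Type u} [Field k] {𝔤 : Type v} [LieRing 𝔤] [LieAlgebra k 𝔤] {n : ℕ}

/-- `Λ(𝔤) ⊗ Ŝ(𝔤*)` is generated by the `dx̂ᵢ` and the power series. -/
theorem forms_induction (b : Module.Basis (Fin n) k 𝔤) {C : Forms k 𝔤 n → Prop}
    (hf : ∀ f, C (series k 𝔤 n f)) (hdx : ∀ i, C (dx b i))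
    (hmul : ∀ ω η, C ω → C η → C (ω * η)) (hadd : ∀ ω η, C ω → C η → C (ω + η))
    (ω : Forms k 𝔤 n) : C ω := by
  have hzero : C 0 := by rw [← map_zero (series k 𝔤 n)]; exact hf 0
  have hΛ : ∀ a : ExteriorAlgebra k 𝔤, C (a ⊗ₜ[k] 1) := fun a => by
    induction a using ExteriorAlgebra.induction with
    | algebraMap r =>
      have hr : ((algebraMap k (ExteriorAlgebra k 𝔤) r) ⊗ₜ[k] 1 : Forms k 𝔤 n)
          = series k 𝔤 n (algebraMap k _ r) := by
        rw [AlgHom.commutes]; rfl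
      rw [hr]
      exact hf _
    | ι m =>
      refine Submodule.span_induction
        (p := fun m _ => C (ExteriorAlgebra.ι k m ⊗ₜ[k] 1)) ?_ ?_ ?_ ?_ (b.mem_span m)
      · rintro _ ⟨i, rfl⟩
        exact hdx i
      · rw [map_zero, TensorProduct.zero_tmul]
        exact hzero
      · intro x y _ _ hx hy
        rw [map_add, TensorProduct.add_tmul]
        exact hadd _ _ hx hy
      -- Closure under scalars is not assumed; it comes from multiplication by constant series.
      · intro r x _ hx
        have h := hmul _ _ hx (hf (algebraMap k _ r))
        rw [AlgHom.commutes, ← Algebra.commutes, ← Algebra.smul_def, TensorProduct.smul_tmul',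
          ← map_smul] at h
        exact h
    | mul a c ha hc =>
      have hac : ((a * c) ⊗ₜ[k] 1 : Forms k 𝔤 n) = (a ⊗ₜ[k] 1) * (c ⊗ₜ[k] 1) := by simp
      rw [hac]
      exact hmul _ _ ha hc
    | add a c ha hc => rw [TensorProduct.add_tmul]; exact hadd _ _ ha hc
  induction ω using TensorProduct.induction_on with
  | zero => exact hzero
  | add ω η h h' => exact hadd _ _ h h'
  | tmul a f => rw [tmul_eq_series]; exact hmul _ _ (hΛ a) (hf f)

end Forms

namespace ExtendedForms

variable {k : Type u} [Field k] [CharZero k] {𝔤 : Type v} [LieRing 𝔤] [LieAlgebra k 𝔤] {n : ℕ}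
  (b : Module.Basis (Fin n) k 𝔤)
  (φ : 𝔤 →ₗ⁅k⁆ Derivation k (MvPowerSeries (Fin n) k) (MvPowerSeries (Fin n) k))
  (hφ : IsUnit (phiMatrix b φ))

theorem xHat_eq (i : Fin n) : xHat b φ hφ i = SmashProduct.ofLie (formExtension b φ hφ) (b i) := rfl

theorem ofSeries_apply (f : MvPowerSeries (Fin n) k) :
    ofSeries b φ hφ f = SmashProduct.inclRight (formExtension b φ hφ) (series k 𝔤 n f) := rfl

theorem ofSeries_mul_ofLie (f : MvPowerSeries (Fin n) k) (x : 𝔤) :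
    ofSeries b φ hφ f * SmashProduct.ofLie (formExtension b φ hφ) x
      = SmashProduct.ofLie (formExtension b φ hφ) x * ofSeries b φ hφ f
        - ofSeries b φ hφ (φ x f) := by
  rw [ofSeries_apply, SmashProduct.inclRight_mul_ofLie, (formExtension_spec b φ hφ).apply_series]
  rfl

variable {b φ hφ} in
/-- The extended algebra is generated by the `x̂ᵢ`, the `dx̂ᵢ` and the power series. -/
theorem induction_generators {C : ExtendedForms b φ hφ → Prop} (hx : ∀ i, C (xHat b φ hφ i))
    (hdx : ∀ i, C (dxHat b φ hφ i)) (hf : ∀ f, C (ofSeries b φ hφ f))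
    (hmul : ∀ s t, C s → C t → C (s * t)) (hadd : ∀ s t, C s → C t → C (s + t))
    (s : ExtendedForms b φ hφ) : C s := by
  refine SmashProduct.induction_generators (fun x => ?_) (fun ω => ?_) hmul hadd s
  · refine Submodule.span_induction
      (p := fun x _ => C (SmashProduct.ofLie (formExtension b φ hφ) x)) ?_ ?_ ?_ ?_ (b.mem_span x)
    · rintro _ ⟨i, rfl⟩
      exact hx i
    · rw [map_zero, ← map_zero (ofSeries b φ hφ)]
      exact hf 0
    · intro x y _ _ h h'
      rw [map_add]
      exact hadd _ _ h h'
    · intro r x _ h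
      have h' := hmul _ _ (hf (algebraMap k _ r)) h
      rw [AlgHom.commutes, ← Algebra.smul_def, ← map_smul] at h'
      exact h'
  · induction ω using forms_induction b with
    | hf f => exact hf f
    | hdx i => exact hdx i
    | hmul ω η h h' => rw [map_mul]; exact hmul _ _ h h'
    | hadd ω η h h' => rw [map_add]; exact hadd _ _ h h'

theorem adjoin_eq_top : Algebra.adjoin k (Set.range (xHat b φ hφ) ∪ Set.range (dxHat b φ hφ) ∪
    Set.range (ofSeries b φ hφ)) = ⊤ := by
  refine eq_top_iff.mpr fun s _ => ?_
  induction s using induction_generators with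
  | hx i => exact Algebra.subset_adjoin (Or.inl (Or.inl ⟨i, rfl⟩))
  | hdx i => exact Algebra.subset_adjoin (Or.inl (Or.inr ⟨i, rfl⟩))
  | hf f => exact Algebra.subset_adjoin (Or.inr ⟨f, rfl⟩)
  | hmul s t hs ht => exact mul_mem (hs trivial) (ht trivial)
  | hadd s t hs ht => exact add_mem (hs trivial) (ht trivial)

/-- The cross relation reads `a x̂ⱼ - x̂ⱼ a = ψ(-x̂ⱼ)(a)`, which explains why `φ` and its extension
are specified at `-x̂ⱼ`. -/
theorem twistedRelations : TwistedRelations b φ (ofSeries b φ hφ) (xHat b φ hφ) (dxHat b φ hφ)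
    (partialGen b φ hφ) where
  x_x i j := by
    have h : ∀ x y : 𝔤, SmashProduct.ofLie (formExtension b φ hφ) x *
        SmashProduct.ofLie (formExtension b φ hφ) y =
        SmashProduct.mk _ (UniversalEnvelopingAlgebra.ι k x * UniversalEnvelopingAlgebra.ι k y) 1 :=
      fun x y => SmashProduct.mk_mul_mk_one _ _ _
    have hlie : SmashProduct.ofLie (formExtension b φ hφ) ⁅b i, b j⁆
        = xHat b φ hφ i * xHat b φ hφ j - xHat b φ hφ j * xHat b φ hφ i := by
      rw [xHat_eq, xHat_eq, h, h, SmashProduct.ofLie_apply, LieHom.map_lie,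
        LieRing.of_associative_ring_bracket]
      exact TensorProduct.sub_tmul _ _ _
    rw [← hlie]
    conv_lhs => rw [← b.sum_repr ⁅b i, b j⁆]
    rw [map_sum]
    exact Finset.sum_congr rfl fun l _ => map_smul _ _ _
  p_p i j := by
    rw [partialGen, partialGen, ← map_mul, ← map_mul, mul_comm, sub_self]
  p_x i j := by
    rw [partialGen, xHat_eq, ofSeries_mul_ofLie, sub_sub_cancel_left, ← map_neg, phiMatrix,
      Matrix.of_apply, map_neg φ]
    rfl
  p_dx i j := by
    rw [partialGen, dxHat, ofSeries_apply, ← map_mul, ← map_mul, (series_commute _ _).eq, sub_self]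
  dx_x i j := by
    have h := congrArg (SmashProduct.inclRight (formExtension b φ hφ))
      ((formExtension_spec b φ hφ).apply_dx j i)
    rw [dxHat, xHat_eq, SmashProduct.inclRight_mul_ofLie, sub_sub_cancel_left, ← map_neg]
    rw [map_neg (formExtension b φ hφ)] at h
    refine h.trans ?_
    simp only [map_sum, map_mul]
    -- The two inner sums occur in opposite orders in `IsFormExtension` and in `TwistedRelations`.
    refine Finset.sum_congr rfl fun s _ => Finset.sum_comm.trans ?_
    rfl
  dx_dx i j := by
    rw [dxHat, dxHat, ← map_mul, ← map_mul, ← map_add, dx_mul_dx, map_zero]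

/-! ### The `∂`-adic topology is a ring topology -/

theorem mem_nhds_iff_orderIdeal {a : ExtendedForms b φ hφ} {s : Set (ExtendedForms b φ hφ)} :
    s ∈ 𝓝 a ↔ ∃ N, ∀ c ∈ orderIdeal b φ hφ N, a + c ∈ s := by
  rw [mem_nhds_iff]
  constructor
  · rintro ⟨t, hts, ht, ha⟩
    obtain ⟨N, hN⟩ := ht a ha
    exact ⟨N, fun c hc => hts (hN c hc)⟩
  · rintro ⟨N, hN⟩
    -- The coset of `a` is itself open, because the ideal is closed under addition.
    refine ⟨{x | x - a ∈ orderIdeal b φ hφ N}, fun x hx => ?_, fun x hx => ⟨N, fun c hc => ?_⟩, ?_⟩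
    · rw [← add_sub_cancel a x]
      exact hN _ hx
    · rw [Set.mem_ofPred_eq, add_sub_right_comm]
      exact add_mem hx hc
    · rw [Set.mem_ofPred_eq, sub_self]
      exact zero_mem _

theorem hasBasis_nhds (a : ExtendedForms b φ hφ) :
    (𝓝 a).HasBasis (fun _ : ℕ => True) fun N => {x | x - a ∈ orderIdeal b φ hφ N} := by
  refine ⟨fun s => (mem_nhds_iff_orderIdeal b φ hφ).trans (exists_congr fun N => ?_)⟩
  rw [true_and]
  refine ⟨fun h x hx => ?_, fun h c hc => h ?_⟩
  · rw [← add_sub_cancel a x]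
    exact h _ hx
  · rw [Set.mem_ofPred_eq, add_sub_cancel_left]
    exact hc

theorem hasBasis_nhds_zero :
    (𝓝 (0 : ExtendedForms b φ hφ)).HasBasis (fun _ : ℕ => True)
      fun N => (orderIdeal b φ hφ N : Set (ExtendedForms b φ hφ)) := by
  have h := hasBasis_nhds b φ hφ 0
  simp only [sub_zero] at h
  exact h

theorem ofSeries_mem_orderIdeal {N : ℕ} {f : MvPowerSeries (Fin n) k}
    (hf : f ∈ seriesIdeal k n ^ N) : ofSeries b φ hφ f ∈ orderIdeal b φ hφ N :=
  Ideal.subset_span ⟨f, hf, rfl⟩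

/-- Left factors are absorbed by the target left ideal, so only the generating series have to be
moved past `a`. -/
theorem orderIdeal_mul_mem {M N : ℕ} {a : ExtendedForms b φ hφ}
    (h : ∀ f ∈ seriesIdeal k n ^ M, ofSeries b φ hφ f * a ∈ orderIdeal b φ hφ N)
    {c : ExtendedForms b φ hφ} (hc : c ∈ orderIdeal b φ hφ M) : c * a ∈ orderIdeal b φ hφ N := by
  refine Submodule.span_induction (p := fun c _ => c * a ∈ orderIdeal b φ hφ N) ?_ ?_ ?_ ?_ hc
  · rintro _ ⟨f, hf, rfl⟩
    exact h f hf
  · rw [zero_mul]; exact zero_mem _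
  · intro x y _ _ hx hy
    rw [add_mul]; exact add_mem hx hy
  · intro r x _ hx
    rw [smul_eq_mul, mul_assoc]
    exact Ideal.mul_mem_left _ r hx

/-- Right multiplications are continuous at zero. -/
theorem exists_orderIdeal_mul_mem (a : ExtendedForms b φ hφ) (N : ℕ) :
    ∃ M, ∀ c ∈ orderIdeal b φ hφ M, c * a ∈ orderIdeal b φ hφ N := by
  induction a using SmashProduct.induction_generators generalizing N with
  | hx x =>
    -- The correction term `φ(x) f` has lost one order, hence `N + 1`.
    refine ⟨N + 1, fun c hc => orderIdeal_mul_mem b φ hφ (fun f hf => ?_) hc⟩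
    rw [ofSeries_mul_ofLie]
    exact sub_mem (Ideal.mul_mem_left _ _
      (ofSeries_mem_orderIdeal b φ hφ (Ideal.pow_le_pow_right N.le_succ hf)))
      (ofSeries_mem_orderIdeal b φ hφ (derivation_mem_pow (φ x) hf))
  | ha ω =>
    -- Series commute with forms, so no order is lost.
    refine ⟨N, fun c hc => orderIdeal_mul_mem b φ hφ (fun f hf => ?_) hc⟩
    have h : ofSeries b φ hφ f * SmashProduct.inclRight (formExtension b φ hφ) ω
        = SmashProduct.inclRight (formExtension b φ hφ) ω * ofSeries b φ hφ f := by
      rw [ofSeries_apply, ← map_mul, ← map_mul, (series_commute ω f).eq]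
    rw [h]
    exact Ideal.mul_mem_left _ _ (ofSeries_mem_orderIdeal b φ hφ hf)
  | hmul s t hs ht =>
    obtain ⟨M, hM⟩ := ht N
    obtain ⟨L, hL⟩ := hs M
    exact ⟨L, fun c hc => by rw [← mul_assoc]; exact hM _ (hL c hc)⟩
  | hadd s t hs ht =>
    obtain ⟨M, hM⟩ := ht N
    obtain ⟨L, hL⟩ := hs N
    refine ⟨max L M, fun c hc => ?_⟩
    rw [mul_add]
    exact add_mem (hL c (orderIdeal_anti b φ hφ (le_max_left L M) hc))
      (hM c (orderIdeal_anti b φ hφ (le_max_right L M) hc))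

instance instIsTopologicalRing : IsTopologicalRing (ExtendedForms b φ hφ) where
  continuous_add := by
    rw [continuous_iff_continuousAt]
    rintro ⟨a, a'⟩
    rw [ContinuousAt, nhds_prod_eq,
      ((hasBasis_nhds b φ hφ a).prod (hasBasis_nhds b φ hφ a')).tendsto_iff
        (hasBasis_nhds b φ hφ (a + a'))]
    refine fun N _ => ⟨(N, N), ⟨trivial, trivial⟩, fun x hx => ?_⟩
    rw [Set.mem_ofPred_eq, add_sub_add_comm]
    exact add_mem hx.1 hx.2
  continuous_mul := by
    rw [continuous_iff_continuousAt]
    rintro ⟨a, a'⟩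
    rw [ContinuousAt, nhds_prod_eq,
      ((hasBasis_nhds b φ hφ a).prod (hasBasis_nhds b φ hφ a')).tendsto_iff
        (hasBasis_nhds b φ hφ (a * a'))]
    intro N _
    obtain ⟨M, hM⟩ := exists_orderIdeal_mul_mem b φ hφ a' N
    refine ⟨(M, N), ⟨trivial, trivial⟩, fun x hx => ?_⟩
    -- In this splitting the variable left factor `x.1` multiplies an element of a left ideal, and
    -- the only right multiplication is by the fixed `a'`.
    have h : x.1 * x.2 - a * a' = x.1 * (x.2 - a') + (x.1 - a) * a' := by noncomm_ring
    rw [Set.mem_ofPred_eq, h]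
    exact add_mem (Ideal.mul_mem_left _ _ hx.2) (hM _ hx.1)
  continuous_neg := by
    rw [continuous_iff_continuousAt]
    intro a
    rw [ContinuousAt, (hasBasis_nhds b φ hφ a).tendsto_iff (hasBasis_nhds b φ hφ (-a))]
    refine fun N _ => ⟨N, trivial, fun x hx => ?_⟩
    rw [Set.mem_ofPred_eq, ← neg_sub', ← Ideal.neg_mem_iff, neg_neg]
    exact hx

theorem isLinearTopology : IsLinearTopology (ExtendedForms b φ hφ) (ExtendedForms b φ hφ) :=
  IsLinearTopology.mk_of_hasBasis _ (hasBasis_nhds_zero b φ hφ)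

theorem continuous_ofSeries : Continuous[seriesTopology k n, _] (ofSeries b φ hφ) := by
  let _ := seriesTopology k n
  have := isTopologicalRing_series (k := k) (n := n)
  refine continuous_of_continuousAt_zero (ofSeries b φ hφ) ?_
  rw [ContinuousAt, map_zero, hasBasis_nhds_zero_series.tendsto_iff (hasBasis_nhds_zero b φ hφ)]
  exact fun N _ => ⟨N, trivial, fun f hf => ofSeries_mem_orderIdeal b φ hφ hf⟩

/-! ### Freeness over the power series, and separation -/

open scoped Classical in
/-- The coordinates in `Ŝ(𝔤*)` with respect to a basis of `U(𝔤) ⊗ Λ(𝔤)`. -/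
def coordinates : ExtendedForms b φ hφ ≃ₗ[k]
    (Module.Basis.ofVectorSpaceIndex k (UniversalEnvelopingAlgebra k 𝔤 ⊗[k] ExteriorAlgebra k 𝔤) →₀
      MvPowerSeries (Fin n) k) :=
  (TensorProduct.assoc k (UniversalEnvelopingAlgebra k 𝔤) (ExteriorAlgebra k 𝔤)
    (MvPowerSeries (Fin n) k)).symm.trans
  (TensorProduct.equivFinsuppOfBasisLeft (Module.Basis.ofVectorSpace k _))

/-- A series multiplied from the right acts on the last tensor factor only, so the coordinates are
those of a free right `Ŝ(𝔤*)`-module. -/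
theorem coordinates_mul_ofSeries (s : ExtendedForms b φ hφ) (f : MvPowerSeries (Fin n) k) (i) :
    coordinates b φ hφ (s * ofSeries b φ hφ f) i = coordinates b φ hφ s i * f := by
  classical
  induction s using SmashProduct.induction_mk with
  | zero => simp
  | add s t hs ht =>
    rw [add_mul, map_add, map_add, Finsupp.add_apply, Finsupp.add_apply, hs, ht, add_mul]
  | mk u ω =>
    rw [ofSeries_apply, SmashProduct.mk_mul_inclRight]
    induction ω using TensorProduct.induction_on with
    | zero =>
      have h : SmashProduct.mk (formExtension b φ hφ) u 0 = 0 := TensorProduct.tmul_zero _ _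
      rw [zero_mul, h]
      simp
    | add ω η h h' =>
      have hmk : ∀ ω η, SmashProduct.mk (formExtension b φ hφ) u (ω + η)
          = SmashProduct.mk _ u ω + SmashProduct.mk _ u η := fun ω η => TensorProduct.tmul_add _ _ _
      rw [add_mul, hmk, hmk, map_add, map_add, Finsupp.add_apply, Finsupp.add_apply, h, h', add_mul]
    | tmul a g =>
      have hg : ((a ⊗ₜ[k] g : Forms k 𝔤 n) * series k 𝔤 n f) = a ⊗ₜ[k] (g * f) := by simp [series]
      have hcoord : ∀ g, coordinates b φ hφ (SmashProduct.mk _ u (a ⊗ₜ[k] g)) i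
          = (Module.Basis.ofVectorSpace k _).repr (u ⊗ₜ[k] a) i • g := fun g =>
        TensorProduct.equivFinsuppOfBasisLeft_apply_tmul_apply _ _ _ _
      rw [hg, hcoord, hcoord, smul_mul_assoc]

theorem coordinates_mem {N : ℕ} {s : ExtendedForms b φ hφ} (hs : s ∈ orderIdeal b φ hφ N) (i) :
    coordinates b φ hφ s i ∈ seriesIdeal k n ^ N := by
  refine Submodule.span_induction
    -- Coordinates do not behave well under left multiplication, so the claim is strengthened to all
    -- left multiples `t * s` and used at `t = 1`.
    (p := fun s _ => ∀ t, coordinates b φ hφ (t * s) i ∈ seriesIdeal k n ^ N)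
    ?_ ?_ ?_ ?_ hs 1 |> fun h => by rwa [one_mul] at h
  · rintro _ ⟨f, hf, rfl⟩ t
    rw [coordinates_mul_ofSeries]
    exact Ideal.mul_mem_left _ _ hf
  · intro t
    rw [mul_zero, map_zero]
    exact zero_mem _
  · intro x y _ _ hx hy t
    rw [mul_add, map_add]
    exact add_mem (hx t) (hy t)
  · intro r x _ hx t
    rw [smul_eq_mul, ← mul_assoc]
    exact hx _

instance instT2Space : T2Space (ExtendedForms b φ hφ) := by
  refine IsTopologicalAddGroup.t2Space_of_zero_sep fun s hs => ?_
  by_contra! h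
  refine hs ((coordinates b φ hφ).map_eq_zero_iff.mp (Finsupp.ext fun i => ?_))
  ext d
  -- An element outside no neighbourhood of zero lies in every left ideal of the basis; the power
  -- `d.degree + 1` is the first that kills the coefficient at `d`.
  refine coeff_eq_zero_of_mem_pow (N := d.degree + 1) (coordinates_mem b φ hφ ?_ i) d.degree.lt_succ_self
  exact h _ ((hasBasis_nhds_zero b φ hφ).mem_of_mem trivial)

/-- The closure of a subalgebra is a subalgebra, so it need only contain the generators; it contains
the series because polynomials are dense and `ofSeries` is continuous. -/
theorem dense_adjoin : Dense (Algebra.adjoin k (Set.range (xHat b φ hφ) ∪ Set.range (dxHat b φ hφ) ∪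
    Set.range (partialGen b φ hφ)) : Set (ExtendedForms b φ hφ)) := by
  set S := Algebra.adjoin k (Set.range (xHat b φ hφ) ∪ Set.range (dxHat b φ hφ) ∪
    Set.range (partialGen b φ hφ)) with hS
  intro s
  rw [← Subalgebra.topologicalClosure_coe, SetLike.mem_coe]
  induction s using induction_generators with
  | hx i => exact S.le_topologicalClosure (Algebra.subset_adjoin (Or.inl (Or.inl ⟨i, rfl⟩)))
  | hdx i => exact S.le_topologicalClosure (Algebra.subset_adjoin (Or.inl (Or.inr ⟨i, rfl⟩)))
  | hf f =>
    let _ := seriesTopology k n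
    refine (denseRange_polynomial (k := k) (n := n)).induction_on f
      (S.isClosed_topologicalClosure.preimage (continuous_ofSeries b φ hφ)) fun p => ?_
    exact S.le_topologicalClosure (polynomial_mem (ofSeries b φ hφ) S
      (fun i => Algebra.subset_adjoin (Or.inr ⟨i, rfl⟩)) p)
  | hmul s t hs ht => exact mul_mem hs ht
  | hadd s t hs ht => exact add_mem hs ht

end ExtendedForms

/-! ### The universal property -/

section Universal

variable {k : Type u} [Field k] {𝔤 : Type v} [LieRing 𝔤] [LieAlgebra k 𝔤] {n : ℕ}
  {b : Module.Basis (Fin n) k 𝔤}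
  {φ : 𝔤 →ₗ⁅k⁆ Derivation k (MvPowerSeries (Fin n) k) (MvPowerSeries (Fin n) k)}
  {B : Type w} [Ring B] [Algebra k B] {e : MvPowerSeries (Fin n) k →ₐ[k] B} {X Y P : Fin n → B}

namespace TwistedRelations

/-- The Lie algebra map `x̂ᵢ ↦ Xᵢ`. -/
def lieHom (h : TwistedRelations b φ e X Y P) : 𝔤 →ₗ⁅k⁆ B :=
  { b.constr k X with
    map_lie' := fun {x y} => by
      change b.constr k X ⁅x, y⁆ = ⁅b.constr k X x, b.constr k X y⁆
      -- Both sides are bilinear, so the relation between the `Xᵢ` settles the matter on basis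
      -- vectors.
      refine Submodule.span_induction₂ (p := fun x y _ _ =>
        b.constr k X ⁅x, y⁆ = ⁅b.constr k X x, b.constr k X y⁆) ?_ ?_ ?_ ?_ ?_ ?_ ?_
        (b.mem_span x) (b.mem_span y)
      · rintro _ _ ⟨i, rfl⟩ ⟨j, rfl⟩
        rw [Module.Basis.constr_basis, Module.Basis.constr_basis,
          LieRing.of_associative_ring_bracket, h.x_x, Module.Basis.constr_apply_fintype]
        rfl
      · intro y _; simp
      · intro x _; simp
      · intro x y z _ _ _ hx hy; rw [add_lie, map_add, hx, hy, map_add, add_lie]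
      · intro x y z _ _ _ hx hy; rw [lie_add, map_add, hx, hy, map_add, lie_add]
      · intro r x y _ _ hx; rw [smul_lie, map_smul, hx, map_smul, smul_lie]
      · intro r x y _ _ hx; 
        rw [lie_smul, map_smul, hx, map_smul, LieRing.of_associative_ring_bracket,
          LieRing.of_associative_ring_bracket, mul_smul_comm, smul_mul_assoc, smul_sub] }

theorem lieHom_basis (h : TwistedRelations b φ e X Y P) (i : Fin n) : h.lieHom (b i) = X i :=
  b.constr_basis k X i

section Topological

variable [TopologicalSpace B] [IsTopologicalRing B] [T2Space B]
  (h : TwistedRelations b φ e X Y P) (he : Continuous[seriesTopology k n, _] e)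
  (hP : ∀ i, e (MvPowerSeries.X i) = P i)

include h he hP

/-- Both sides are continuous in `f` with values in a Hausdorff space, so polynomials suffice; their
images lie in the centralizer of `Yᵢ` because the `Pⱼ` do. -/
theorem commute_series (f : MvPowerSeries (Fin n) k) (i : Fin n) : Commute (Y i) (e f) := by
  let _ := seriesTopology k n
  refine (denseRange_polynomial (k := k) (n := n)).induction_on
    (p := fun f => Y i * e f = e f * Y i) f
    (isClosed_eq (continuous_const.mul he) (he.mul continuous_const)) fun p => ?_
  have hp : e p ∈ Subalgebra.centralizer k {Y i} :=
    polynomial_mem e _ (fun j => by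
      rw [Subalgebra.mem_centralizer_iff]
      rintro _ rfl
      rw [hP]
      exact (sub_eq_zero.mp (h.p_dx i j)).symm) p
  exact (Subalgebra.mem_centralizer_iff k).mp hp _ rfl

/-- Again a closed condition on `f`, now thanks to the automatic continuity of `φ (b i)`. On
polynomials it propagates from the `Pⱼ` by the Leibniz rule. -/
theorem series_mul_X (f : MvPowerSeries (Fin n) k) (i : Fin n) :
    e f * X i = X i * e f - e (φ (b i) f) := by
  let _ := seriesTopology k n
  refine (denseRange_polynomial (k := k) (n := n)).induction_on
    (p := fun f => e f * X i = X i * e f - e (φ (b i) f)) f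
    (isClosed_eq (he.mul continuous_const)
      ((continuous_const.mul he).sub (he.comp (continuous_derivation (φ (b i)))))) fun p => ?_
  induction p using MvPolynomial.induction_on with
  | C r =>
    have hr : ((MvPolynomial.C r : MvPolynomial (Fin n) k) : MvPowerSeries (Fin n) k)
        = algebraMap k _ r := by rw [MvPolynomial.coe_C]; rfl
    rw [hr, Derivation.map_algebraMap, map_zero, sub_zero, AlgHom.commutes, Algebra.commutes]
  | add p q hp hq =>
    rw [MvPolynomial.coe_add, map_add, map_add, map_add, add_mul, mul_add, hp, hq]
    abel
  | mul_X p j hp =>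
    have hj : P j * X i = X i * P j - e (φ (b i) (MvPowerSeries.X j)) := by
      have := h.p_x i j
      rw [phiMatrix, Matrix.of_apply, map_neg, Derivation.neg_apply, map_neg] at this
      rw [sub_eq_iff_eq_add.mp this]
      abel
    rw [MvPolynomial.coe_mul, MvPolynomial.coe_X, Derivation.leibniz, map_mul, hP, mul_assoc, hj,
      mul_sub, ← mul_assoc, hp, map_add, smul_eq_mul, smul_eq_mul, mul_comm (MvPowerSeries.X j),
      map_mul, map_mul, hP]
    noncomm_ring

end Topological

variable [CharZero k]

/-- Anticommutation extends bilinearly from the `Yᵢ`; on the diagonal it gives twice the square, and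
`2` is invertible. -/
theorem constr_sq (h : TwistedRelations b φ e X Y P) (m : 𝔤) :
    b.constr k Y m * b.constr k Y m = 0 := by
  have key : ∀ x y : 𝔤, b.constr k Y x * b.constr k Y y + b.constr k Y y * b.constr k Y x = 0 := by
    intro x y
    refine Submodule.span_induction₂ (p := fun x y _ _ =>
      b.constr k Y x * b.constr k Y y + b.constr k Y y * b.constr k Y x = 0) ?_ ?_ ?_ ?_ ?_ ?_ ?_
      (b.mem_span x) (b.mem_span y)
    · rintro _ _ ⟨i, rfl⟩ ⟨j, rfl⟩
      rw [Module.Basis.constr_basis, Module.Basis.constr_basis, h.dx_dx]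
    · intro y _; simp
    · intro x _; simp
    · intro x y z _ _ _ hx hy
      rw [map_add, add_mul, mul_add, add_add_add_comm, hx, hy, add_zero]
    · intro x y z _ _ _ hx hy
      rw [map_add, add_mul, mul_add, add_add_add_comm, hx, hy, add_zero]
    · intro r x y _ _ hx
      rw [map_smul, smul_mul_assoc, mul_smul_comm, ← smul_add, hx, smul_zero]
    · intro r x y _ _ hx
      rw [map_smul, smul_mul_assoc, mul_smul_comm, ← smul_add, hx, smul_zero]
  have h2 : (2 : k) • (b.constr k Y m * b.constr k Y m) = 0 := by rw [two_smul, key]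
  exact (smul_eq_zero.mp h2).resolve_left two_ne_zero

/-- The algebra map on the exterior algebra with `dx̂ᵢ ↦ Yᵢ`. -/
def exteriorHom (h : TwistedRelations b φ e X Y P) : ExteriorAlgebra k 𝔤 →ₐ[k] B :=
  ExteriorAlgebra.lift k ⟨b.constr k Y, h.constr_sq⟩

theorem exteriorHom_ι (h : TwistedRelations b φ e X Y P) (m : 𝔤) :
    h.exteriorHom (ExteriorAlgebra.ι k m) = b.constr k Y m :=
  ExteriorAlgebra.lift_ι_apply _ _ _ _

section Topological

variable [TopologicalSpace B] [IsTopologicalRing B] [T2Space B]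
  (h : TwistedRelations b φ e X Y P) (he : Continuous[seriesTopology k n, _] e)
  (hP : ∀ i, e (MvPowerSeries.X i) = P i)

include h he hP

theorem commute_exteriorHom (a : ExteriorAlgebra k 𝔤) (f : MvPowerSeries (Fin n) k) :
    Commute (h.exteriorHom a) (e f) := by
  induction a using ExteriorAlgebra.induction with
  | algebraMap r => rw [AlgHom.commutes]; exact Algebra.commutes r _
  | ι m =>
    rw [exteriorHom_ι, Module.Basis.constr_apply_fintype]
    exact Commute.sum_left _ _ _ fun i _ => (h.commute_series he hP f i).smul_left _
  | mul a c ha hc => rw [map_mul]; exact ha.mul_left hc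
  | add a c ha hc => rw [map_add]; exact ha.add_left hc

/-- The algebra map on `Λ(𝔤) ⊗ Ŝ(𝔤*)` with `dx̂ᵢ ↦ Yᵢ` that extends `e`. -/
def formsHom : Forms k 𝔤 n →ₐ[k] B :=
  Algebra.TensorProduct.lift h.exteriorHom e (h.commute_exteriorHom he hP)

theorem formsHom_series (f : MvPowerSeries (Fin n) k) :
    h.formsHom he hP (series k 𝔤 n f) = e f := by
  simp [formsHom, series]

theorem formsHom_dx (i : Fin n) : h.formsHom he hP (dx b i) = Y i := by
  simp [formsHom, dx, exteriorHom_ι]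

/-- As `formExtension` acts by derivations, the identity passes to products of forms, and it is
linear in `x`. What remains is `series_mul_X` on series and the relation `dx_x` on the `dx̂ₗ`. -/
theorem formsHom_mul_lieHom (hφ : IsUnit (phiMatrix b φ)) (x : 𝔤) (ω : Forms k 𝔤 n) :
    h.formsHom he hP ω * h.lieHom x = h.lieHom x * h.formsHom he hP ω
      - h.formsHom he hP ((formExtension b φ hφ x : Module.End k (Forms k 𝔤 n)) ω) := by
  induction ω using forms_induction b with
  | hmul ω η hω hη =>
    rw [(formExtension b φ hφ x).2, map_mul, map_add, map_mul, map_mul, mul_assoc, hη, mul_sub,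
      ← mul_assoc, hω]
    noncomm_ring
  | hadd ω η hω hη =>
    simp only [map_add, add_mul, mul_add, hω, hη]
    abel
  | hf f =>
    rw [(formExtension_spec b φ hφ).apply_series, formsHom_series, formsHom_series]
    refine Submodule.span_induction (p := fun x _ =>
      e f * h.lieHom x = h.lieHom x * e f - e (φ x f)) ?_ ?_ ?_ ?_ (b.mem_span x)
    · rintro _ ⟨i, rfl⟩
      rw [lieHom_basis, h.series_mul_X he hP]
    · simp
    · intro x y _ _ hx hy
      rw [map_add, map_add, Derivation.add_apply, map_add, mul_add, add_mul, hx, hy]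
      abel
    · intro r x _ hx
      rw [map_smul, map_smul, Derivation.smul_apply, map_smul, mul_smul_comm, smul_mul_assoc, hx,
        smul_sub]
  | hdx l =>
    rw [formsHom_dx]
    refine Submodule.span_induction (p := fun x _ =>
      Y l * h.lieHom x = h.lieHom x * Y l
        - h.formsHom he hP ((formExtension b φ hφ x : Module.End k (Forms k 𝔤 n)) (dx b l)))
      ?_ ?_ ?_ ?_ (b.mem_span x)
    · rintro _ ⟨i, rfl⟩
      have h1 := congrArg (h.formsHom he hP) ((formExtension_spec b φ hφ).apply_dx i l)
      have h2 : h.formsHom he hP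
          ((formExtension b φ hφ (-b i) : Module.End k (Forms k 𝔤 n)) (dx b l))
          = Y l * X i - X i * Y l := by
        rw [h1, h.dx_x]
        simp only [map_sum, map_mul, formsHom_dx, formsHom_series]
        exact Finset.sum_congr rfl fun s _ => Finset.sum_comm
      -- The extension is prescribed at `-b i`, whereas the identity is stated at `b i`.
      have h3 : h.formsHom he hP
          ((formExtension b φ hφ (-b i) : Module.End k (Forms k 𝔤 n)) (dx b l))
          = - h.formsHom he hP
            ((formExtension b φ hφ (b i) : Module.End k (Forms k 𝔤 n)) (dx b l)) := by
        rw [map_neg (formExtension b φ hφ), ← map_neg (h.formsHom he hP)]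
        rfl
      rw [lieHom_basis, sub_eq_add_neg, ← h3, h2, add_sub_cancel]
    · simp
    · intro x y _ _ hx hy
      have hadd : (formExtension b φ hφ (x + y) : Module.End k (Forms k 𝔤 n)) (dx b l)
          = (formExtension b φ hφ x : Module.End k (Forms k 𝔤 n)) (dx b l)
            + (formExtension b φ hφ y : Module.End k (Forms k 𝔤 n)) (dx b l) := by
        rw [map_add]; rfl
      rw [hadd, map_add, map_add, mul_add, add_mul, hx, hy]
      abel
    · intro r x _ hx
      have hsmul : (formExtension b φ hφ (r • x) : Module.End k (Forms k 𝔤 n)) (dx b l)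
          = r • (formExtension b φ hφ x : Module.End k (Forms k 𝔤 n)) (dx b l) := by
        rw [map_smul]; rfl
      rw [hsmul, map_smul, map_smul, mul_smul_comm, smul_mul_assoc, hx, smul_sub]

/-- No continuity of `F` is claimed, so `B` may have any Hausdorff ring topology. -/
theorem exists_algHom (hφ : IsUnit (phiMatrix b φ)) :
    ∃ F : ExtendedForms b φ hφ →ₐ[k] B, (∀ f, F (ofSeries b φ hφ f) = e f) ∧
      (∀ i, F (xHat b φ hφ i) = X i) ∧ (∀ i, F (dxHat b φ hφ i) = Y i) := by
  have hcomm : ∀ x ω, h.formsHom he hP ω *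
      UniversalEnvelopingAlgebra.lift k h.lieHom (UniversalEnvelopingAlgebra.ι k x)
      = UniversalEnvelopingAlgebra.lift k h.lieHom (UniversalEnvelopingAlgebra.ι k x) *
        h.formsHom he hP ω
        - h.formsHom he hP ((formExtension b φ hφ x : Module.End k (Forms k 𝔤 n)) ω) := by
    intro x ω
    rw [UniversalEnvelopingAlgebra.lift_ι_apply]
    exact h.formsHom_mul_lieHom he hP hφ x ω
  refine ⟨SmashProduct.lift _ _ hcomm, fun f => ?_, fun i => ?_, fun i => ?_⟩
  · rw [ofSeries_apply, SmashProduct.lift_inclRight, formsHom_series]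
  · rw [xHat_eq, SmashProduct.lift_ofLie, UniversalEnvelopingAlgebra.lift_ι_apply, lieHom_basis]
  · rw [dxHat, SmashProduct.lift_inclRight, formsHom_dx]

end Topological

end TwistedRelations

/-! ### Uniqueness and continuity -/

namespace ExtendedForms

variable [CharZero k] {hφ : IsUnit (phiMatrix b φ)}

theorem algHom_ext {F G : ExtendedForms b φ hφ →ₐ[k] B}
    (hf : ∀ f, F (ofSeries b φ hφ f) = G (ofSeries b φ hφ f))
    (hx : ∀ i, F (xHat b φ hφ i) = G (xHat b φ hφ i))
    (hdx : ∀ i, F (dxHat b φ hφ i) = G (dxHat b φ hφ i)) : F = G := by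
  refine AlgHom.ext fun s => ?_
  induction s using induction_generators with
  | hx i => exact hx i
  | hdx i => exact hdx i
  | hf f => exact hf f
  | hmul s t hs ht => rw [map_mul, map_mul, hs, ht]
  | hadd s t hs ht => rw [map_add, map_add, hs, ht]

variable [TopologicalSpace B]

/-- The preimage of an open left ideal is a left ideal. By continuity on series it contains some
`𝔪^N`, hence all of `E 𝔪^N`. This is where left ideals in the topology of `B` are needed. -/
theorem continuous_of_comp_ofSeries [IsTopologicalRing B] [IsLinearTopology B B] (F : ExtendedForms b φ hφ →ₐ[k] B)
    (he : Continuous[seriesTopology k n, _] fun f => F (ofSeries b φ hφ f)) : Continuous F := by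
  let _ := seriesTopology k n
  refine continuous_of_continuousAt_zero F ?_
  rw [ContinuousAt, map_zero,
    (hasBasis_nhds_zero b φ hφ).tendsto_iff (IsLinearTopology.hasBasis_ideal (R := B))]
  intro J hJ
  have h0 : Filter.Tendsto (fun f => F (ofSeries b φ hφ f)) (𝓝 0) (𝓝 0) := by
    simpa using he.tendsto 0
  obtain ⟨N, -, hN⟩ := hasBasis_nhds_zero_series.mem_iff.mp (h0 hJ)
  refine ⟨N, trivial, fun s hs => ?_⟩
  have hle : orderIdeal b φ hφ N ≤ J.comap (F : ExtendedForms b φ hφ →+* B) := by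
    refine Ideal.span_le.mpr ?_
    rintro _ ⟨f, hf, rfl⟩
    exact hN hf
  exact hle hs

theorem continuous_algHom_ext [T2Space B] {F G : ExtendedForms b φ hφ →ₐ[k] B} (hF : Continuous F)
    (hG : Continuous G) (hp : ∀ i, F (partialGen b φ hφ i) = G (partialGen b φ hφ i))
    (hx : ∀ i, F (xHat b φ hφ i) = G (xHat b φ hφ i))
    (hdx : ∀ i, F (dxHat b φ hφ i) = G (dxHat b φ hφ i)) : F = G := by
  have h : Set.EqOn F G (Algebra.adjoin k (Set.range (xHat b φ hφ) ∪ Set.range (dxHat b φ hφ) ∪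
      Set.range (partialGen b φ hφ))) := by
    refine AlgHom.eqOn_adjoin_iff.mpr ?_
    rintro _ ((⟨i, rfl⟩ | ⟨i, rfl⟩) | ⟨i, rfl⟩)
    exacts [hx i, hdx i, hp i]
  exact DFunLike.coe_injective (hF.ext_on (dense_adjoin b φ hφ) hG h)

end ExtendedForms

end Universal

end TwistedForms

end

theorem proposition2p2 {k : Type u} [Field k] [CharZero k]
    {𝔤 : Type v} [LieRing 𝔤] [LieAlgebra k 𝔤] {n : ℕ} (b : Module.Basis (Fin n) k 𝔤)
    (φ : 𝔤 →ₗ⁅k⁆ Derivation k (MvPowerSeries (Fin n) k) (MvPowerSeries (Fin n) k))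
    (hφ : IsUnit (phiMatrix b φ)) :
    -- the relations hold in the extended algebra of twisted differential forms
    TwistedRelations b φ (ofSeries b φ hφ) (xHat b φ hφ) (dxHat b φ hφ) (partialGen b φ hφ) ∧
    -- it is a Hausdorff, linearly topologized algebra, where power series in the `∂ⁱ` converge
    (IsTopologicalRing (ExtendedForms b φ hφ) ∧ T2Space (ExtendedForms b φ hφ) ∧
      IsLinearTopology (ExtendedForms b φ hφ) (ExtendedForms b φ hφ) ∧
      Continuous[seriesTopology k n, _] (ofSeries b φ hφ)) ∧
    -- it is generated by the `3n` symbols, when power series in the `∂ⁱ` are admitted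
    (Dense (Algebra.adjoin k (Set.range (xHat b φ hφ) ∪ Set.range (dxHat b φ hφ) ∪
        Set.range (partialGen b φ hφ)) : Set (ExtendedForms b φ hφ)) ∧
      Algebra.adjoin k (Set.range (xHat b φ hφ) ∪ Set.range (dxHat b φ hφ) ∪
        Set.range (ofSeries b φ hφ)) = ⊤) ∧
    -- every other relation is a consequence: universal property of the presentation
    (∀ {B : Type w} [Ring B] [Algebra k B] [TopologicalSpace B] [IsTopologicalRing B] [T2Space B]
      (e : MvPowerSeries (Fin n) k →ₐ[k] B) (X Y P : Fin n → B),
      Continuous[seriesTopology k n, _] e → (∀ i, e (MvPowerSeries.X i) = P i) →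
      TwistedRelations b φ e X Y P →
      (∃! F : ExtendedForms b φ hφ →ₐ[k] B, (∀ f, F (ofSeries b φ hφ f) = e f) ∧
        (∀ i, F (xHat b φ hφ i) = X i) ∧ (∀ i, F (dxHat b φ hφ i) = Y i)) ∧
      (IsLinearTopology B B →
        ∃! F : ExtendedForms b φ hφ →ₐ[k] B, Continuous F ∧
          (∀ i, F (partialGen b φ hφ i) = P i) ∧
          (∀ i, F (xHat b φ hφ i) = X i) ∧ (∀ i, F (dxHat b φ hφ i) = Y i))) := by
  refine ⟨twistedRelations b φ hφ,
    ⟨instIsTopologicalRing b φ hφ, instT2Space b φ hφ, isLinearTopology b φ hφ,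
      continuous_ofSeries b φ hφ⟩,
    ⟨dense_adjoin b φ hφ, adjoin_eq_top b φ hφ⟩, ?_⟩
  intro B _ _ _ _ _ e X Y P he hP h
  -- One `F` serves both claims. Uniqueness is algebraic when all series are prescribed, and follows
  -- from density when only the `∂ⁱ` are.
  obtain ⟨F, hf, hx, hdx⟩ := h.exists_algHom he hP hφ
  refine ⟨⟨F, ⟨hf, hx, hdx⟩, fun G hG => ?_⟩, fun _ => ⟨F, ⟨?_, ?_, hx, hdx⟩, fun G hG => ?_⟩⟩
  · exact algHom_ext (fun f => (hG.1 f).trans (hf f).symm)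
      (fun i => (hG.2.1 i).trans (hx i).symm) fun i => (hG.2.2 i).trans (hdx i).symm
  · exact continuous_of_comp_ofSeries F (by simpa only [hf] using he)
  · exact fun i => (hf _).trans (hP i)
  · have hFc : Continuous F := continuous_of_comp_ofSeries F (by simpa only [hf] using he)
    exact continuous_algHom_ext hG.1 hFc (fun i => (hG.2.1 i).trans ((hf _).trans (hP i)).symm)
      (fun i => (hG.2.2.1 i).trans (hx i).symm) fun i => (hG.2.2.2 i).trans (hdx i).symm
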